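/- \textbf{Notation.} All functions are considered on $\mathbb R_+=\,]0,\infty[$. A lattice is a full-rank discrete subgroup of $\mathbb R^n$. For a lattice $\Lambda$, let $\Theta_\Lambda(y)=\sum_{x\in\Lambda}e^{-\pi\|x\|^2y}$ and $\Lambda^\ast=\{v\in\mathbb R^n: v\cdot w\in\mathbb Z\text{ for all }w\in\Lambda\}$; $\Lambda$ is integral if $v\cdot w\in\mathbb Z$ for all $v,w\in\Lambda$. For $\ell\in\mathbb Z_+$ put \[C^\ell=\bigoplus_{d\mid\ell}\sqrt d\,\mathbb Z,\qquad D^\ell=\mathbb Z\oplus\sqrt\ell\,\mathbb Z,\] where $d$ runs over the positive divisors of $\ell$, and let $(C^\ell)^k$ be the orthogonal direct sum of $k$ copies of $C^\ell$. The modified secrecy function of an $n$-dimensional lattice $\Lambda$ is \[\widetilde\Xi_\Lambda(y)=\frac{\Theta_{D^\ell}(y)^{n/2}}{\Theta_\Lambda(y)}.\] Let $\eta(y)=e^{-\pi y/12}\prod_{m\ge1}(1-e^{-2\pi my})$ and $\eta^{(\ell)}(y)=\prod_{d\mid\ell}\eta(dy)$. With $d(\ell)$ the number of positive divisors of $\ell$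 and $D_\ell=24\,d(\ell)/\prod_{p\mid\ell,\ p\text{ prime}}(p+1)$, define \[g_\ell(y)=\left(\frac{\eta^{(\ell)}(y/2)\,\eta^{(\ell)}(2y)}{\eta^{(\ell)}(y)^2}\right)^{D_\ell/d(\ell)}\ (\ell\text{ odd}),\qquad g_\ell(y)=\left(\frac{\eta^{(\ell/2)}(y/2)\,\eta^{(\ell/2)}(4y)}{\eta^{(\ell/2)}(y)\,\eta^{(\ell/2)}(2y)}\right)^{D_\ell/d(\ell)}\ (\ell\text{ even}).\] For a set $\Pi$ of primes, the $\Pi$-dual $\Lambda^{\ast\Pi}$ of an integral lattice $\Lambda$ consists of all $v\in\Lambda\otimes\mathbb Q$ with $v\cdot\Lambda\subseteq\mathbb Z_p$ for primes $p\in\Pi$ and $v\cdot\Lambda^\ast\subseteq\mathbb Z_p$ for primes $p\notin\Pi$. A modularity of level $m$ of $\Lambda$ is a linear similarity $\sigma$ of $\mathbb R^n$ with $\sigma(x)\cdot\sigma(x)=m\,(x\cdot x)$ for all $x$ and $\sigma(\Lambda^{\ast\Pi})=\Lambda$, where $\Pi$ is the set of primes dividing $m$. An integral lattice $\Lambda$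 is strongly $\ell$-modular if the smallest $\ell'\in\mathbb Z_+$ for which $\sqrt{\ell'}\,\Lambda^\ast$ is integral divides $\ell$, and $\Lambda$ has a modularity of level $m$ for every positive divisor $m$ of $\ell$ with $\gcd(m,\ell/m)=1$. Lattices $\Lambda,\Lambda'$ are called rationally equivalent if the rational quadratic spaces $\Lambda\otimes\mathbb Q$ and $\Lambda'\otimes\mathbb Q$ are isometric (that is, some linear isometry of the ambient Euclidean spaces maps the $\mathbb Q$-span of $\Lambda$ onto that of $\Lambda'$). In the theorem, the alternative coordinate condition that $\Lambda=A\Lambda'$ for an invertible matrix $A\in\mathbb Q^{n\times n}$ is allowed as well. \textbf{Theorem.} Let $\ell\in\{6,14,15\}$, let $k$ be a positive integer, and let $\Lambda$ be a strongly $\ell$-modular lattice that is rationally equivalent to $(C^\ell)^k$ in either of the two senses above. Let $N\ge0$ be an integer and let $c_0,\dots,c_N$ be real numbers such that \[\Theta_\Lambda(y)=\Theta_{C^\ell}(y)^k\sum_{i=0}^Nc_i\,g_\ell(y)^i\qquad\text{for all }y>0.\] Assume that \[\sum_{i=0}^Nc_i\,x^i\ \ge\ \sum_{i=0}^Nc_i\,g_\ell\!\left(\tfrac1{\sqrt\ell}\right)^i\qquad\text{for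 all }x\in\left]0,\,g_\ell\!\left(\tfrac1{\sqrt\ell}\right)\right].\] Then $\widetilde\Xi_\Lambda$ has a unique global maximum at $1/\sqrt\ell$, i.e. $\widetilde\Xi_\Lambda(y)<\widetilde\Xi_\Lambda(1/\sqrt\ell)$ for all $y>0$ with $y\ne1/\sqrt\ell$. -/

import Mathlib

open scoped Pointwise

namespace ModularLattice

noncomputable section

/-- The standard bilinear form `(x, y) ↦ x · y` of a Euclidean space, as a real bilinear form. -/
abbrev dotForm (ι : Type*) [Fintype ι] : LinearMap.BilinForm ℝ (EuclideanSpace ℝ ι) :=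
  innerₗ (EuclideanSpace ℝ ι)

/-- The dual `Λ^*`: all vectors `v` with `v · w ∈ ℤ` for every `w ∈ Λ`. -/
def dual {ι : Type*} [Fintype ι] (Λ : Submodule ℤ (EuclideanSpace ℝ ι)) :
    Submodule ℤ (EuclideanSpace ℝ ι) :=
  (dotForm ι).dualSubmodule Λ

/-- `Λ` is integral: all inner products of its vectors are integers. -/
def IsIntegral {ι : Type*} [Fintype ι] (Λ : Submodule ℤ (EuclideanSpace ℝ ι)) : Prop :=
  ∀ v ∈ Λ, ∀ w ∈ Λ, ∃ z : ℤ, inner ℝ v w = (z : ℝ)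

/-- The rational span `Λ ⊗ ℚ` of `Λ` inside the ambient real space. -/
def ratSpan {ι : Type*} [Fintype ι] (Λ : Submodule ℤ (EuclideanSpace ℝ ι)) :
    Submodule ℚ (EuclideanSpace ℝ ι) :=
  Submodule.span ℚ (Λ : Set (EuclideanSpace ℝ ι))

/-- The real number `r` is rational and lies in the ring `ℤ_p` of `p`-adic integers
(`p` prime), that is, `p` does not divide its denominator. -/
def IsPIntegral (p : ℕ) (r : ℝ) : Prop :=
  ∃ q : ℚ, r = (q : ℝ) ∧ ¬ p ∣ q.den

/-- The `Π`-dual of `Λ` (here `P` is the set of primes `Π`): the vectors `v ∈ Λ ⊗ ℚ` with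
`v · Λ ⊆ ℤ_p` for the primes `p ∈ Π` and `v · Λ^* ⊆ ℤ_p` for the primes `p ∉ Π`. -/
def piDual {ι : Type*} [Fintype ι] (P : Set ℕ) (Λ : Submodule ℤ (EuclideanSpace ℝ ι)) :
    Set (EuclideanSpace ℝ ι) :=
  {v | v ∈ ratSpan Λ ∧
    (∀ p : ℕ, p.Prime → p ∈ P → ∀ w ∈ Λ, IsPIntegral p (inner ℝ v w)) ∧
    (∀ p : ℕ, p.Prime → p ∉ P → ∀ w ∈ dual Λ, IsPIntegral p (inner ℝ v w))}

/-- `Λ` has a modularity of level `m`: a similarity `σ` of the ambient space that multiplies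
norms `x · x` by `m` and maps the `Π`-dual onto `Λ`, where `Π` is the set of primes dividing `m`. -/
def HasModularity {ι : Type*} [Fintype ι] (m : ℕ) (Λ : Submodule ℤ (EuclideanSpace ℝ ι)) : Prop :=
  ∃ σ : EuclideanSpace ℝ ι ≃ₗ[ℝ] EuclideanSpace ℝ ι,
    (∀ x, inner ℝ (σ x) (σ x) = (m : ℝ) * inner ℝ x x) ∧
    σ '' piDual {p : ℕ | p.Prime ∧ p ∣ m} Λ = (Λ : Set (EuclideanSpace ℝ ι))

/-- `Λ` is strongly `ℓ`-modular: it is integral, the smallest positive integer `ℓ'` for which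
`√ℓ' Λ^*` is integral divides `ℓ`, and `Λ` has a modularity of level `m` for every
divisor `m` of `ℓ` that is coprime to `ℓ / m`. -/
structure IsStronglyModular {ι : Type*} [Fintype ι] (ℓ : ℕ)
    (Λ : Submodule ℤ (EuclideanSpace ℝ ι)) : Prop where
  integral : IsIntegral Λ
  level : ∃ ℓ' : ℕ, IsLeast {m : ℕ | 0 < m ∧ IsIntegral (Real.sqrt (m : ℝ) • dual Λ)} ℓ' ∧ ℓ' ∣ ℓ
  modularity : ∀ m ∈ ℓ.divisors, Nat.Coprime m (ℓ / m) → HasModularity m Λ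

/-- Rational equivalence of lattices as quadratic forms over `ℚ`: some isometry of the ambient
spaces maps `Λ ⊗ ℚ` onto `Λ' ⊗ ℚ`. -/
def RationallyEquivalent {ι κ : Type*} [Fintype ι] [Fintype κ]
    (Λ : Submodule ℤ (EuclideanSpace ℝ ι)) (Λ' : Submodule ℤ (EuclideanSpace ℝ κ)) : Prop :=
  ∃ f : EuclideanSpace ℝ ι ≃ₗᵢ[ℝ] EuclideanSpace ℝ κ,
    f '' (ratSpan Λ : Set (EuclideanSpace ℝ ι)) = (ratSpan Λ' : Set (EuclideanSpace ℝ κ))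

/-- Rational equivalence in coordinates: `Λ = A Λ'` for an invertible matrix `A` with rational
entries with respect to the standard bases of the ambient spaces. -/
def RationalMatrixEquivalent {ι κ : Type*} [Fintype ι] [Fintype κ] [DecidableEq ι] [DecidableEq κ]
    (Λ : Submodule ℤ (EuclideanSpace ℝ ι)) (Λ' : Submodule ℤ (EuclideanSpace ℝ κ)) : Prop :=
  ∃ (A : Matrix ι κ ℚ) (B : Matrix κ ι ℚ), A * B = 1 ∧ B * A = 1 ∧
    (Λ : Set (EuclideanSpace ℝ ι)) =
      Matrix.toEuclideanLin (A.map (fun q : ℚ => (q : ℝ))) '' (Λ' : Set (EuclideanSpace ℝ κ))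

/-- The theta series `Θ_Λ(y) = ∑_{x ∈ Λ} exp (-π ‖x‖² y)`, `y > 0`. -/
def theta {ι : Type*} [Fintype ι] (Λ : Submodule ℤ (EuclideanSpace ℝ ι)) (y : ℝ) : ℝ :=
  ∑' x : Λ, Real.exp (-Real.pi * ‖(x : EuclideanSpace ℝ ι)‖ ^ 2 * y)

/-- The orthogonal direct sum `⨁ᵢ √(a i) ℤ`. -/
def sqrtLattice {ι : Type*} [Fintype ι] (a : ι → ℕ) : Submodule ℤ (EuclideanSpace ℝ ι) where
  carrier := {x | ∀ i, ∃ z : ℤ, x i = Real.sqrt (a i) * (z : ℝ)}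
  zero_mem' := fun i => ⟨0, by simp⟩
  add_mem' := by
    intro x y hx hy i
    obtain ⟨z, hz⟩ := hx i
    obtain ⟨w, hw⟩ := hy i
    exact ⟨z + w, by simp [hz, hw, mul_add]⟩
  smul_mem' := by
    intro c x hx i
    obtain ⟨z, hz⟩ := hx i
    exact ⟨c * z, by simp [hz, mul_left_comm]⟩

/-- The lattice `C^ℓ = ⨁_{d ∣ ℓ} √d ℤ`, one summand for each positive divisor of `ℓ`. -/
def latticeC (ℓ : ℕ) : Submodule ℤ (EuclideanSpace ℝ ℓ.divisors) :=
  sqrtLattice (fun d => (d : ℕ))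

/-- The lattice `D^ℓ = ℤ ⊕ √ℓ ℤ`. -/
def latticeD (ℓ : ℕ) : Submodule ℤ (EuclideanSpace ℝ (Fin 2)) :=
  sqrtLattice ![1, ℓ]

/-- The orthogonal direct sum `Λ^k` of `k` copies of `Λ`. -/
def latticePow {ι : Type*} [Fintype ι] (Λ : Submodule ℤ (EuclideanSpace ℝ ι)) (k : ℕ) :
    Submodule ℤ (EuclideanSpace ℝ (Fin k × ι)) where
  carrier := {x | ∀ j : Fin k, WithLp.toLp 2 (fun i => x (j, i)) ∈ Λ}
  zero_mem' := fun _ => Λ.zero_mem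
  add_mem' := fun hx hy j => Λ.add_mem (hx j) (hy j)
  smul_mem' := fun c _ hx j => Λ.smul_mem c (hx j)

/-- The Dedekind eta function on the imaginary axis, `η(y)` standing for `η(iy)`, `y > 0`. -/
def eta (y : ℝ) : ℝ :=
  Real.exp (-Real.pi * y / 12) *
    ∏' n : ℕ, (1 - Real.exp (-2 * Real.pi * ((n : ℝ) + 1) * y))

/-- `η^{(ℓ)}(y) = ∏_{d ∣ ℓ} η(d y)`. -/
def etaDiv (ℓ : ℕ) (y : ℝ) : ℝ :=
  ∏ d ∈ ℓ.divisors, eta ((d : ℝ) * y)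

/-- `D_ℓ = 24 d(ℓ) / ∏_{p ∣ ℓ} (p + 1)`, with `d(ℓ)` the number of divisors of `ℓ`. -/
def constD (ℓ : ℕ) : ℝ :=
  24 * (ℓ.divisors.card : ℝ) / ∏ p ∈ ℓ.primeFactors, ((p : ℝ) + 1)

/-- The eta quotient `g_ℓ`. Its exponent is `D_ℓ / dim C^ℓ`, where `dim C^ℓ = d(ℓ)`. -/
def g (ℓ : ℕ) (y : ℝ) : ℝ :=
  if Odd ℓ then
    (etaDiv ℓ (y / 2) * etaDiv ℓ (2 * y) / etaDiv ℓ y ^ 2) ^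
      (constD ℓ / (ℓ.divisors.card : ℝ))
  else
    (etaDiv (ℓ / 2) (y / 2) * etaDiv (ℓ / 2) (4 * y) /
        (etaDiv (ℓ / 2) y * etaDiv (ℓ / 2) (2 * y))) ^
      (constD ℓ / (ℓ.divisors.card : ℝ))

/-- The modified secrecy function `Θ_{D^ℓ}(y)^{n/2} / Θ_Λ(y)` of an `n`-dimensional lattice. -/
def modifiedSecrecy (ℓ : ℕ) {n : ℕ} (Λ : Submodule ℤ (EuclideanSpace ℝ (Fin n))) (y : ℝ) : ℝ :=
  theta (latticeD ℓ) y ^ ((n : ℝ) / 2) / theta Λ y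

/-- On the positive reals, `f` has a global maximum at `y₀`, attained at no other point. -/
def HasUniqueGlobalMaxAt (f : ℝ → ℝ) (y₀ : ℝ) : Prop :=
  0 < y₀ ∧ ∀ y : ℝ, 0 < y → y ≠ y₀ → f y < f y₀

end

end ModularLattice

open ModularLattice

/-! Write ℓ = pq with primes p < q. Rational equivalence gives n = 4k, so the secrecy function
equals (Θ_D²/Θ_C)^k / P(g), where P(x) = ∑ c_i x^i and the arguments y are suppressed. The numerator
is strictly maximal at 1/√ℓ. The denominator is minimal there: 0 < g(y) ≤ g(1/√ℓ), so the assumption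
on P applies.

Numerator (`thetaInt_ratio_lt`). With θ = Θ_ℤ the base is θ(y)θ(pqy) / (θ(py)θ(qy)). In t = log y,
Jacobi's inversion makes G(t) = log θ(e^t) + t/4 even, and the logarithm of the base is G(s-a) +
G(s+a) - G(s-b) - G(s+b) with a = log(pq)/2, b = log(q/p)/2, s = log y + a. Such an expression peaks
strictly at s = 0 if G'' decreases strictly on [0, ∞) (`second_difference_lt`). Up to a negative
factor G''' is T(x), x = πe^t. Symmetry forces T(π) = 0, and e^x T(x) increases for x ≥ 3
(`thetaThird_strictMono`), so G''' < 0 for t > 0.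

Bound on g (`g_bounds`). The quotient g is a positive power of a product of pairs f(y)f(py), with f
an eta quotient invariant under y ↦ r²/y. Its product expansion shows that log f is concave in log y
from a point slightly below log r on. With the symmetry, every such pair is maximal when its two
arguments are placed symmetrically about r (`HasWeberExpansion.mul_le`), and this happens at y =
1/√ℓ for every pair in g. -/

namespace ModularLattice

/-! ### Theta series of orthogonal sums, positivity, dimension -/

/-- The theta series of `ℤ` on the imaginary axis. -/
noncomputable def thetaInt (y : ℝ) : ℝ := ∑' z : ℤ, Real.exp (-Real.pi * y * (z : ℝ) ^ 2)

theorem summable_exp_neg_mul_int_sq {a : ℝ} (ha : 0 < a) :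
    Summable fun z : ℤ => Real.exp (-a * (z : ℝ) ^ 2) := by
  have h := (summable_pow_mul_jacobiTheta₂_term_bound 0 (T := a / Real.pi)
    (div_pos ha Real.pi_pos) 0)
  refine h.congr fun z => ?_
  have := Real.pi_ne_zero
  simp
  field_simp

theorem summable_thetaInt {y : ℝ} (hy : 0 < y) :
    Summable fun z : ℤ => Real.exp (-Real.pi * y * (z : ℝ) ^ 2) := by
  simpa only [neg_mul] using summable_exp_neg_mul_int_sq (mul_pos Real.pi_pos hy)

theorem thetaInt_pos {y : ℝ} (hy : 0 < y) : 0 < thetaInt y :=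
  (summable_thetaInt hy).tsum_pos (fun _ => (Real.exp_pos _).le) 0 (Real.exp_pos _)

theorem hasSum_prod_fin {m : ℕ} {α : Type*} (f : Fin m → α → ℝ) (hf : ∀ i z, 0 ≤ f i z)
    (hs : ∀ i, Summable (f i)) :
    HasSum (fun z : Fin m → α => ∏ i, f i (z i)) (∏ i, ∑' z, f i z) := by
  induction m with
  | zero =>
    simp only [Finset.univ_eq_empty, Finset.prod_empty]
    exact hasSum_unique (fun _ : Fin 0 → α => (1 : ℝ))
  | succ m ih =>
    have h1 := ih (fun i => f i.succ) (fun i => hf _) (fun i => hs _)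
    have hnn : 0 ≤ fun z : Fin m → α => ∏ i, f (Fin.succ i) (z i) :=
      fun z => Finset.prod_nonneg fun i _ => hf _ _
    have hsum := (hs 0).mul_of_nonneg h1.summable (fun z => hf 0 z) hnn
    have h2 := (hs 0).hasSum.mul h1 hsum
    rw [Fin.prod_univ_succ, ← (Fin.consEquiv fun _ : Fin (m + 1) => α).hasSum_iff]
    have e : (fun z : Fin (m + 1) → α => ∏ i, f i (z i)) ∘ (Fin.consEquiv fun _ => α) =
        fun x : α × (Fin m → α) => f 0 x.1 * ∏ i, f (Fin.succ i) (x.2 i) := by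
      funext z
      simp only [Function.comp_apply, Fin.prod_univ_succ]
      rfl
    rw [e]
    exact h2

theorem hasSum_prod_pi {ι α : Type*} [Fintype ι] (f : ι → α → ℝ) (hf : ∀ i z, 0 ≤ f i z)
    (hs : ∀ i, Summable (f i)) :
    HasSum (fun z : ι → α => ∏ i, f i (z i)) (∏ i, ∑' z, f i z) := by
  let e := Fintype.equivFin ι
  have h := hasSum_prod_fin (fun j => f (e.symm j)) (fun _ => hf _) (fun _ => hs _)
  rw [e.symm.prod_comp (fun i => ∑' z, f i z)] at h
  rw [← (Equiv.arrowCongr e (Equiv.refl α)).symm.hasSum_iff]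
  convert h using 2 with z
  simp only [Function.comp_apply]
  rw [← e.symm.prod_comp]
  simp [Equiv.arrowCongr]

/-- Integer coordinates on `⨁ᵢ √(a i) ℤ`. -/
noncomputable def sqrtLatticeEquiv {ι : Type*} [Fintype ι] (a : ι → ℕ) (ha : ∀ i, 0 < a i) :
    (ι → ℤ) ≃ sqrtLattice a :=
  Equiv.ofBijective
    (fun z => ⟨WithLp.toLp 2 fun i => Real.sqrt (a i) * (z i : ℝ), fun i => ⟨z i, rfl⟩⟩) <| by
    constructor
    · intro z w h
      funext i
      have h1 := congrArg (fun x : sqrtLattice a => (x : EuclideanSpace ℝ ι) i) h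
      have h2 : Real.sqrt (a i) ≠ 0 := (Real.sqrt_pos.2 (by exact_mod_cast ha i)).ne'
      simpa [h2] using h1
    · rintro ⟨x, hx⟩
      refine ⟨fun i => (hx i).choose, Subtype.ext ?_⟩
      ext i
      exact (hx i).choose_spec.symm

theorem sqrtLatticeEquiv_apply {ι : Type*} [Fintype ι] (a : ι → ℕ) (ha : ∀ i, 0 < a i)
    (z : ι → ℤ) (i : ι) :
    (sqrtLatticeEquiv a ha z : EuclideanSpace ℝ ι) i = Real.sqrt (a i) * (z i : ℝ) := rfl

theorem theta_sqrtLattice {ι : Type*} [Fintype ι] (a : ι → ℕ) (ha : ∀ i, 0 < a i) {y : ℝ}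
    (hy : 0 < y) : theta (sqrtLattice a) y = ∏ i, thetaInt (a i * y) := by
  rw [theta, ← (sqrtLatticeEquiv a ha).tsum_eq]
  have ha' : ∀ i, 0 < (a i : ℝ) * y := fun i => mul_pos (by exact_mod_cast ha i) hy
  rw [show ∏ i, thetaInt (a i * y) = _ from (hasSum_prod_pi _ (fun _ _ => (Real.exp_pos _).le)
    (fun i => summable_thetaInt (ha' i))).tsum_eq.symm]
  refine tsum_congr fun z => ?_
  rw [← Real.exp_sum, EuclideanSpace.norm_sq_eq]
  congr 1
  simp only [sqrtLatticeEquiv_apply, Real.norm_eq_abs, sq_abs]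
  rw [Finset.mul_sum, Finset.sum_mul]
  refine Finset.sum_congr rfl fun i _ => ?_
  rw [mul_pow, Real.sq_sqrt (Nat.cast_nonneg _)]
  ring

theorem theta_latticeD {ℓ : ℕ} (hℓ : 0 < ℓ) {y : ℝ} (hy : 0 < y) :
    theta (latticeD ℓ) y = thetaInt y * thetaInt (ℓ * y) := by
  rw [latticeD, theta_sqrtLattice _ _ hy]
  · simp
  · intro i
    fin_cases i <;> simp [hℓ]

theorem theta_latticeC (ℓ : ℕ) {y : ℝ} (hy : 0 < y) :
    theta (latticeC ℓ) y = ∏ d ∈ ℓ.divisors, thetaInt (d * y) := by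
  rw [latticeC, theta_sqrtLattice _ (fun d => Nat.pos_of_mem_divisors d.2) hy]
  exact Finset.prod_coe_sort ℓ.divisors fun d : ℕ => thetaInt (d * y)

/-- The content is summability, since a divergent `tsum` would be 0. From e^{-t} ≤ r!/t^r the terms
are dominated by a multiple of ‖x‖^{-2r}, with 2r larger than the rank. -/
theorem theta_pos {n : ℕ} (Λ : Submodule ℤ (EuclideanSpace ℝ (Fin n))) [DiscreteTopology Λ]
    {y : ℝ} (hy : 0 < y) : 0 < theta Λ y := by
  refine Summable.tsum_pos ?_ (fun _ => (Real.exp_pos _).le) 0 (Real.exp_pos _)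
  set r := Module.finrank ℤ Λ + 1 with hr
  have h0 := ZLattice.summable_norm_pow_inv Λ (2 * r) (by omega)
  refine Summable.of_norm_bounded_eventually (h0.mul_left (r.factorial / (Real.pi * y) ^ r)) ?_
  -- The comparison fails only at x = 0, where `‖x‖⁻¹` is 0 by convention.
  have hsub : {x : Λ | ¬ ‖Real.exp (-Real.pi * ‖(x : EuclideanSpace ℝ (Fin n))‖ ^ 2 * y)‖ ≤
      r.factorial / (Real.pi * y) ^ r * ‖x‖⁻¹ ^ (2 * r)} ⊆ {0} := by
    intro x hx
    by_contra h
    apply hx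
    have hx0 : 0 < ‖x‖ := norm_pos_iff.2 h
    have h1 := Real.pow_div_factorial_le_exp (Real.pi * y * ‖x‖ ^ 2) (by positivity) r
    rw [Real.norm_eq_abs, Real.abs_exp, show -Real.pi * ‖(x : EuclideanSpace ℝ (Fin n))‖ ^ 2 * y
      = -(Real.pi * y * ‖x‖ ^ 2) by rw [Submodule.coe_norm]; ring, Real.exp_neg]
    have h2 : (0 : ℝ) < (Real.pi * y * ‖x‖ ^ 2) ^ r / r.factorial := by positivity
    calc _ ≤ ((Real.pi * y * ‖x‖ ^ 2) ^ r / r.factorial)⁻¹ := by gcongr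
      _ = _ := by
        rw [inv_div, mul_pow, ← pow_mul, inv_pow]
        field_simp
  exact (Set.finite_singleton _).subset hsub

/-- This turns the exponent n/2 of the secrecy function into 2k. Both forms of equivalence come with
a linear isomorphism of coordinate spaces. -/
theorem card_eq_of_rationallyEquivalent {n k ℓ : ℕ} {Λ : Submodule ℤ (EuclideanSpace ℝ (Fin n))}
    {Λ' : Submodule ℤ (EuclideanSpace ℝ (Fin k × ℓ.divisors))}
    (h : RationallyEquivalent Λ Λ' ∨ RationalMatrixEquivalent Λ Λ') :
    n = k * ℓ.divisors.card := by
  have h' : Fintype.card (Fin n) = Fintype.card (Fin k × ℓ.divisors) := by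
    rcases h with ⟨f, -⟩ | ⟨A, B, h1, h2, -⟩
    · simpa using f.toLinearEquiv.finrank_eq
    · have e := (Matrix.toLin'OfInv h1 h2)
      simpa using e.finrank_eq
  simpa using h'

/-! ### Second differences of even functions -/

/-- If `G` is even with an even second derivative that decreases strictly on `[0, ∞)`, then
`G (s - a) + G (s + a) - G (s - b) - G (s + b)` is strictly maximal at `s = 0`. -/
theorem second_difference_lt {G k H : ℝ → ℝ} (hG : ∀ t, G (-t) = G t)
    (hk : ∀ t, HasDerivAt G (k t) t) (hH : ∀ t, HasDerivAt k (H t) t)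
    (hkodd : ∀ t, k (-t) = -k t) (hHeven : ∀ t, H (-t) = H t)
    (hanti : StrictAntiOn H (Set.Ici 0)) {a b : ℝ} (hb : 0 ≤ b) (hab : b < a) {s : ℝ}
    (hs : s ≠ 0) :
    G (s - a) + G (s + a) - G (s - b) - G (s + b) < G a + G a - G b - G b := by
  wlog hpos : 0 < s generalizing s
  · have h := this (s := -s) (neg_ne_zero.2 hs) (by
      rcases lt_or_gt_of_ne hs with h | h
      · linarith
      · exact absurd h hpos)
    have e : ∀ c, G (-s - c) = G (s + c) ∧ G (-s + c) = G (s - c) := fun c =>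
      ⟨by rw [← hG]; ring_nf, by rw [← hG]; ring_nf⟩
    rw [(e a).1, (e a).2, (e b).1, (e b).2] at h
    linarith
  have hder : ∀ u, HasDerivAt (fun s => G (s - a) + G (s + a) - G (s - b) - G (s + b))
      (k (u - a) + k (u + a) - k (u - b) - k (u + b)) u := fun u =>
    ((((hk (u - a)).comp_sub_const u a).add ((hk (u + a)).comp_add_const u a)).sub
      ((hk (u - b)).comp_sub_const u b)).sub ((hk (u + b)).comp_add_const u b)
  have hlt : ∀ u, 0 < u → k (u - a) + k (u + a) - k (u - b) - k (u + b) < 0 := by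
    intro u hu
    -- As k is odd, the derivative in s is m(a) - m(b) with m(c) = k(u+c) - k(c-u). Here m
    -- decreases, because m'(c) = H(u+c) - H(|c-u|) and |c-u| < u+c.
    have hm : ∀ c, HasDerivAt (fun c => k (u + c) - k (c - u)) (H (u + c) - H (c - u)) c :=
      fun c => ((hH (u + c)).comp_const_add u c).sub ((hH (c - u)).comp_sub_const c u)
    have hmono : StrictAntiOn (fun c => k (u + c) - k (c - u)) (Set.Ici 0) := by
      refine strictAntiOn_of_deriv_neg (convex_Ici 0)
        (fun c _ => (hm c).continuousAt.continuousWithinAt) fun c hc => ?_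
      rw [interior_Ici, Set.mem_Ioi] at hc
      rw [(hm c).deriv, sub_neg]
      have habs : H (c - u) = H |c - u| := by
        rcases abs_choice (c - u) with h | h <;> rw [h]
        rw [hHeven]
      rw [habs]
      refine hanti (Set.mem_Ici.2 (abs_nonneg _)) (Set.mem_Ici.2 (by linarith)) ?_
      rw [abs_lt]
      constructor <;> linarith
    have h := hmono (Set.mem_Ici.2 hb) (Set.mem_Ici.2 (hb.trans hab.le)) hab
    have ea := hkodd (a - u)
    have eb := hkodd (b - u)
    rw [neg_sub] at ea eb
    simp only at h
    linarith
  have hanti' := strictAntiOn_of_deriv_neg (convex_Ici (0 : ℝ))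
    (fun c _ => (hder c).continuousAt.continuousWithinAt) fun c hc => by
      rw [interior_Ici, Set.mem_Ioi] at hc
      rw [(hder c).deriv]
      exact hlt c hc
  have h := hanti' (Set.mem_Ici.2 le_rfl) (Set.mem_Ici.2 hpos.le) hpos
  simpa [hG] using h

/-! ### Moments of the theta series and estimates for x ≥ 3 -/

/-- The moment series `∑_{n ≥ 1} n^{2j} exp (-n² x)`. -/
noncomputable def thetaMoment (j : ℕ) (x : ℝ) : ℝ :=
  ∑' n : ℕ, ((n : ℝ) + 1) ^ (2 * j) * Real.exp (-((n : ℝ) + 1) ^ 2 * x)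

theorem summable_thetaMoment (j : ℕ) {x : ℝ} (hx : 0 < x) :
    Summable fun n : ℕ => ((n : ℝ) + 1) ^ (2 * j) * Real.exp (-((n : ℝ) + 1) ^ 2 * x) := by
  have h := HurwitzKernelBounds.summable_f_nat (2 * j) 1 (div_pos hx Real.pi_pos)
  refine h.congr fun n => ?_
  have := Real.pi_ne_zero
  rw [HurwitzKernelBounds.f_nat]
  congr 2
  field_simp

theorem hasDerivAt_thetaMoment (j : ℕ) {x : ℝ} (hx : 0 < x) :
    HasDerivAt (thetaMoment j) (-thetaMoment (j + 1) x) x := by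
  have h2 : 0 < x / 2 := by linarith
  have hmem : x ∈ Set.Ioi (x / 2) := Set.mem_Ioi.2 (by linarith)
  have h := hasDerivAt_tsum_of_isPreconnected (𝕜 := ℝ) (y₀ := x) (y := x)
    (g := fun (n : ℕ) (x : ℝ) => ((n : ℝ) + 1) ^ (2 * j) * Real.exp (-((n : ℝ) + 1) ^ 2 * x))
    (g' := fun (n : ℕ) (x : ℝ) =>
      -(((n : ℝ) + 1) ^ (2 * (j + 1)) * Real.exp (-((n : ℝ) + 1) ^ 2 * x)))
    (summable_thetaMoment (j + 1) h2) isOpen_Ioi isPreconnected_Ioi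
    (fun n y _ => by
      have := ((hasDerivAt_id y).const_mul (-((n : ℝ) + 1) ^ 2)).exp.const_mul
        (((n : ℝ) + 1) ^ (2 * j))
      refine this.congr_deriv ?_
      simp only [id]
      ring)
    (fun n y hy => by
      rw [norm_neg, Real.norm_of_nonneg (by positivity)]
      have : x / 2 ≤ y := (Set.mem_Ioi.1 hy).le
      gcongr ?_ * Real.exp ?_
      nlinarith [sq_nonneg ((n : ℝ) + 1)])
    hmem (summable_thetaMoment j hx) hmem
  rw [tsum_neg] at h
  exact h

theorem exp_neg_le_thetaMoment (j : ℕ) {x : ℝ} (hx : 0 < x) :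
    Real.exp (-x) ≤ thetaMoment j x := by
  have h := (summable_thetaMoment j hx).le_tsum 0 fun n _ => by positivity
  simpa [thetaMoment] using h

theorem thetaMoment_mono {i j : ℕ} (hij : i ≤ j) {x : ℝ} (hx : 0 < x) :
    thetaMoment i x ≤ thetaMoment j x := by
  refine (summable_thetaMoment i hx).tsum_le_tsum (fun n => ?_) (summable_thetaMoment j hx)
  gcongr
  · linarith [(Nat.cast_nonneg n : (0 : ℝ) ≤ n)]

/-- With q = e^{-x}, the n = 2 term is 256 q⁴. The later ones decay geometrically with ratio at most
1/257, which raises 256 to 257. -/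
theorem thetaMoment_four_le {x : ℝ} (hx : 3 ≤ x) :
    thetaMoment 4 x ≤ Real.exp (-x) * (1 + 257 * Real.exp (-x) ^ 3) := by
  have hx0 : 0 < x := by linarith
  set q := Real.exp (-x) with hq
  have hq0 : 0 < q := Real.exp_pos _
  have hr : Real.exp (4 - 5 * x) ≤ 1 / 257 := by
    have h1 : Real.exp (4 - 5 * x) ≤ Real.exp (-8) := Real.exp_le_exp.2 (by linarith)
    have h2 : Real.exp (-8) = (Real.exp (-1)) ^ 8 := by
      rw [← Real.exp_nat_mul]; norm_num
    have h3 : Real.exp (-1) < 0.37 := by linarith [Real.exp_neg_one_lt_d9]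
    have h4 : (Real.exp (-1)) ^ 8 ≤ 0.37 ^ 8 := by
      gcongr
    rw [h2] at h1
    norm_num at h4 ⊢
    linarith
  set r := Real.exp (4 - 5 * x) with hrdef
  have hr0 : 0 < r := Real.exp_pos _
  -- The tail index m stands for the integer m + 2. Then (m+2)⁸ = 256(m/2+1)⁸ ≤ 256 e^{4m} and
  -- (m+2)² ≥ 4 + 5m, which produces r = e^{4-5x}.
  have hgeo : HasSum (fun m : ℕ => 256 * q ^ 4 * r ^ m) (256 * q ^ 4 * (1 - r)⁻¹) :=
    (hasSum_geometric_of_lt_one hr0.le (by linarith)).mul_left _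
  have hs := summable_thetaMoment 4 hx0
  rw [thetaMoment, hs.tsum_eq_zero_add]
  have htail : ∑' n : ℕ, (((n + 1 : ℕ) : ℝ) + 1) ^ (2 * 4) *
      Real.exp (-(((n + 1 : ℕ) : ℝ) + 1) ^ 2 * x) ≤ 256 * q ^ 4 * (1 - r)⁻¹ := by
    rw [← hgeo.tsum_eq]
    refine ((summable_nat_add_iff 1).2 hs).tsum_le_tsum (fun m => ?_) hgeo.summable
    have hm : (0 : ℝ) ≤ m := Nat.cast_nonneg m
    have e1 : ((((m + 1 : ℕ) : ℝ)) + 1) ^ (2 * 4) ≤ 256 * Real.exp (4 * m) := by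
      have : (m : ℝ) / 2 + 1 ≤ Real.exp (m / 2) := Real.add_one_le_exp _
      have h8 : ((m : ℝ) / 2 + 1) ^ 8 ≤ Real.exp (m / 2) ^ 8 := by gcongr
      rw [← Real.exp_nat_mul] at h8
      calc ((((m + 1 : ℕ) : ℝ)) + 1) ^ (2 * 4) = 256 * ((m : ℝ) / 2 + 1) ^ 8 := by
            push_cast; ring
        _ ≤ 256 * Real.exp (((8 : ℕ) : ℝ) * (m / 2)) := by gcongr
        _ = _ := by congr 2; push_cast; ring
    have hmm : (m : ℝ) ≤ m ^ 2 := by exact_mod_cast Nat.le_self_pow two_ne_zero m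
    calc _ ≤ 256 * Real.exp (4 * m) * Real.exp (-(((m + 1 : ℕ) : ℝ) + 1) ^ 2 * x) := by gcongr
      _ = 256 * Real.exp (4 * m + -(((m + 1 : ℕ) : ℝ) + 1) ^ 2 * x) := by
        rw [Real.exp_add]; ring
      _ ≤ 256 * Real.exp (4 * (-x) + m * (4 - 5 * x)) := by
        refine mul_le_mul_of_nonneg_left (Real.exp_le_exp.2 ?_) (by norm_num)
        push_cast
        nlinarith [mul_le_mul_of_nonneg_right hmm hx0.le]
      _ = _ := by
        rw [Real.exp_add, hq, hrdef, ← Real.exp_nat_mul, ← Real.exp_nat_mul]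
        push_cast
        ring
  have hinv : (1 - r)⁻¹ ≤ 257 / 256 := by
    rw [inv_le_comm₀ (by linarith) (by norm_num)]
    norm_num
    linarith
  have h0 : ((((0 : ℕ) : ℝ)) + 1) ^ (2 * 4) * Real.exp (-(((0 : ℕ) : ℝ) + 1) ^ 2 * x) = q := by
    simp [hq]
  rw [h0]
  have : 256 * q ^ 4 * (1 - r)⁻¹ ≤ 256 * q ^ 4 * (257 / 256) := by gcongr
  nlinarith

theorem thetaInt_eq {y : ℝ} (hy : 0 < y) :
    thetaInt y = 1 + 2 * thetaMoment 0 (Real.pi * y) := by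
  have h := summable_thetaMoment 0 (mul_pos Real.pi_pos hy)
  have h1 : HasSum (fun n : ℕ => Real.exp (-Real.pi * y * ((((n : ℤ) + 1 : ℤ)) : ℝ) ^ 2))
      (thetaMoment 0 (Real.pi * y)) := by
    have e : (fun n : ℕ => Real.exp (-Real.pi * y * ((((n : ℤ) + 1 : ℤ)) : ℝ) ^ 2)) =
        fun n : ℕ => ((n : ℝ) + 1) ^ (2 * 0) * Real.exp (-((n : ℝ) + 1) ^ 2 * (Real.pi * y)) := by
      funext n
      push_cast
      rw [pow_zero, one_mul]
      ring_nf
    rw [e]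
    exact h.hasSum
  have h2 : HasSum (fun n : ℕ => Real.exp (-Real.pi * y * (((Int.negSucc n : ℤ)) : ℝ) ^ 2))
      (thetaMoment 0 (Real.pi * y)) := by
    have e : (fun n : ℕ => Real.exp (-Real.pi * y * (((Int.negSucc n : ℤ)) : ℝ) ^ 2)) =
        fun n : ℕ => Real.exp (-Real.pi * y * ((((n : ℤ) + 1 : ℤ)) : ℝ) ^ 2) := by
      funext n
      rw [Int.cast_negSucc]
      push_cast
      ring_nf
    rw [e]
    exact h1
  have h0 : HasSum (fun n : ℕ => Real.exp (-Real.pi * y * (((n : ℤ)) : ℝ) ^ 2))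
      (1 + thetaMoment 0 (Real.pi * y)) := by
    have := (hasSum_nat_add_iff (f := fun n : ℕ =>
      Real.exp (-Real.pi * y * (((n : ℤ)) : ℝ) ^ 2)) 1).1 (by simpa using h1)
    simpa [add_comm] using this
  have h3 := (HasSum.int_rec h0 h2).tsum_eq
  rw [thetaInt]
  trans 1 + thetaMoment 0 (Real.pi * y) + thetaMoment 0 (Real.pi * y)
  · rw [← h3]
    refine tsum_congr fun z => ?_
    cases z <;> rfl
  · ring

theorem thetaInt_inv {y : ℝ} (hy : 0 < y) : thetaInt y⁻¹ = Real.sqrt y * thetaInt y := by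
  have h := Real.tsum_exp_neg_mul_int_sq hy
  have hs : Real.sqrt y ≠ 0 := (Real.sqrt_pos.2 hy).ne'
  rw [← Real.sqrt_eq_rpow] at h
  simp only [thetaInt]
  rw [h]
  field_simp

/-- `x²C + xB + A` with the moments `S = ∑_{n ∈ ℤ} exp (-n²x)`, `sⱼ = ∑_{n ∈ ℤ} n^{2j} exp (-n²x)`:
up to the factor `-x / S³`, the third derivative of `log S` with respect to `log x`. -/
noncomputable def thetaThird (x : ℝ) : ℝ :=
  x ^ 2 * ((1 + 2 * thetaMoment 0 x) ^ 2 * (2 * thetaMoment 3 x)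
    - 3 * (1 + 2 * thetaMoment 0 x) * (2 * thetaMoment 1 x) * (2 * thetaMoment 2 x)
    + 2 * (2 * thetaMoment 1 x) ^ 3)
  + x * (-3 * (1 + 2 * thetaMoment 0 x) ^ 2 * (2 * thetaMoment 2 x)
    + 3 * (1 + 2 * thetaMoment 0 x) * (2 * thetaMoment 1 x) ^ 2)
  + (1 + 2 * thetaMoment 0 x) ^ 2 * (2 * thetaMoment 1 x)

/-- The expression is T + T', computed with sⱼ' = -sⱼ₊₁ and sorted by powers of x. Every sⱼ is u =
2e^{-x} up to O(u²). In the x² coefficient the first-order terms cancel and about +u² remains, more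
than the error from s3 - s4. The x coefficient is about 2u and the constant one about -3u, so x ≥ 3
decides the sign. -/
theorem thetaThird_add_deriv_pos_aux {x u S s1 s2 s3 s4 : ℝ} (hx : 3 ≤ x) (hu : 0 < u)
    (hu' : u ≤ 1 / 10) (hS : 1 + u ≤ S) (h1 : u ≤ s1) (h12 : s1 ≤ s2) (h23 : s2 ≤ s3)
    (h34 : s3 ≤ s4) (hS' : S ≤ 1 + s4) (h4 : s4 ≤ u + 33 / 100 * u ^ 2) :
    0 < x ^ 2 * (S ^ 2 * (s3 - s4) + S * s1 * s3 - 3 * S * s1 * s2 + 3 * S * s2 ^ 2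
        + 2 * s1 ^ 3 - 3 * s1 ^ 2 * s2)
      + x * (S ^ 2 * (5 * s3 - 3 * s2) - 6 * S * s1 * s2 + 3 * S * s1 ^ 2 + s1 ^ 3)
      + (S ^ 2 * (s1 - 4 * s2) + S * s1 ^ 2) := by
  have h4u : s4 ≤ 1.033 * u := by nlinarith
  have hS2 : S ≤ 1.1033 := by nlinarith
  have hSS : S ^ 2 ≤ 1.22 := by nlinarith
  have hSS1 : 1 ≤ S ^ 2 := by nlinarith
  have hs1 : 0 < s1 := by linarith
  have hs2 : 0 < s2 := by linarith
  have hs3 : 0 < s3 := by linarith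
  have hs1u : s1 ≤ 1.033 * u := by linarith
  have hs2u : s2 ≤ 1.033 * u := by linarith
  have hs11 : s1 ^ 2 ≤ 1.068 * u ^ 2 := by nlinarith
  have hC : 0 ≤ S ^ 2 * (s3 - s4) + S * s1 * s3 - 3 * S * s1 * s2 + 3 * S * s2 ^ 2
        + 2 * s1 ^ 3 - 3 * s1 ^ 2 * s2 := by
    have e1 : S ^ 2 * (s4 - s3) ≤ 1.22 * (33 / 100 * u ^ 2) :=
      mul_le_mul hSS (by linarith) (by linarith) (by norm_num)
    have e2 : u ^ 2 ≤ S * s1 * s3 := by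
      have : u * u ≤ s1 * s3 := mul_le_mul h1 (by linarith) hu.le hs1.le
      have hS1 : 1 ≤ S := by linarith
      nlinarith [mul_pos hs1 hs3]
    have e3 : 0 ≤ S * s2 * (s2 - s1) :=
      mul_nonneg (mul_nonneg (by linarith) hs2.le) (by linarith)
    have e4 : s1 ^ 2 * s2 ≤ 1.068 * u ^ 2 * 0.1033 :=
      mul_le_mul hs11 (by linarith) hs2.le (by positivity)
    have e5 : 0 < s1 ^ 3 := by positivity
    nlinarith [sq_nonneg u]
  have hB : 1.7 * u ≤ S ^ 2 * (5 * s3 - 3 * s2) - 6 * S * s1 * s2 + 3 * S * s1 ^ 2 + s1 ^ 3 := by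
    have e1 : S ^ 2 * (2 * u) ≤ S ^ 2 * (5 * s3 - 3 * s2) := by
      gcongr
      linarith
    have e2 : s1 * s2 ≤ 1.068 * u ^ 2 := by nlinarith
    have e3 : u ^ 2 ≤ s1 ^ 2 := by gcongr
    have e5 : 0 < s1 ^ 3 := by positivity
    have e6 : 1.7 * u ≤ S * (2 * u) - 6 * (s1 * s2) + 3 * s1 ^ 2 := by
      nlinarith
    have e7 : S * (1.7 * u) ≤ S * (S * (2 * u) - 6 * (s1 * s2) + 3 * s1 ^ 2) :=
      mul_le_mul_of_nonneg_left e6 (by linarith)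
    nlinarith
  have hA : -4 * u ≤ S ^ 2 * (s1 - 4 * s2) + S * s1 ^ 2 := by
    have e1 : S ^ 2 * (4 * s2 - s1) ≤ 1.22 * (3.14 * u) :=
      mul_le_mul hSS (by linarith) (by linarith) (by norm_num)
    have e2 : 0 ≤ S * s1 ^ 2 := mul_nonneg (by linarith) (sq_nonneg _)
    linarith
  have hC' := mul_nonneg (sq_nonneg x) hC
  have hB' := mul_le_mul hx hB (by positivity) (by linarith)
  -- The rounded bounds leave 3 · 1.7u - 4u > 0.
  linarith

theorem thetaMoment_bounds {x : ℝ} (hx : 3 ≤ x) :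
    2 * Real.exp (-x) ≤ 1 / 10 ∧
    2 * thetaMoment 4 x ≤ 2 * Real.exp (-x) + 33 / 100 * (2 * Real.exp (-x)) ^ 2 := by
  have h3 : Real.exp (-1) < 0.368 := by linarith [Real.exp_neg_one_lt_d9]
  have h4 : Real.exp (-x) ≤ 0.05 := by
    calc Real.exp (-x) ≤ Real.exp (-3) := Real.exp_le_exp.2 (by linarith)
      _ = Real.exp (-1) ^ 3 := by rw [← Real.exp_nat_mul]; norm_num
      _ ≤ 0.368 ^ 3 := by gcongr
      _ ≤ 0.05 := by norm_num
  refine ⟨by linarith, ?_⟩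
  have h5 := thetaMoment_four_le hx
  have h0 := Real.exp_pos (-x)
  set q := Real.exp (-x)
  have h6 : q * q ^ 3 ≤ 0.0025 * q ^ 2 := by
    have h7 : q ^ 2 ≤ 0.0025 := by nlinarith
    calc q * q ^ 3 = q ^ 2 * q ^ 2 := by ring
      _ ≤ _ := mul_le_mul_of_nonneg_right h7 (sq_nonneg q)
  nlinarith [sq_nonneg q]

/-- The factor e^x cancels the decay of T: to leading order e^x T(x) is 2(x² - 3x + 1), which
increases for x > 3/2. -/
theorem thetaThird_strictMono :
    StrictMonoOn (fun x => Real.exp x * thetaThird x) (Set.Ici 3) := by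
  have hd : ∀ x : ℝ, 3 ≤ x → ∃ d, 0 < d ∧
      HasDerivAt (fun x => Real.exp x * thetaThird x) (Real.exp x * d) x := by
    intro x hx
    have hx0 : 0 < x := by linarith
    obtain ⟨hu, h4⟩ := thetaMoment_bounds hx
    have m := fun i j (h : i ≤ j) => thetaMoment_mono h hx0
    have e0 := exp_neg_le_thetaMoment 0 hx0
    have key := thetaThird_add_deriv_pos_aux hx (u := 2 * Real.exp (-x))
      (S := 1 + 2 * thetaMoment 0 x) (s1 := 2 * thetaMoment 1 x) (s2 := 2 * thetaMoment 2 x)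
      (s3 := 2 * thetaMoment 3 x) (s4 := 2 * thetaMoment 4 x) (by positivity) hu
      (by linarith) (by linarith [exp_neg_le_thetaMoment 1 hx0])
      (by linarith [m 1 2 (by norm_num)]) (by linarith [m 2 3 (by norm_num)])
      (by linarith [m 3 4 (by norm_num)]) (by linarith [m 0 4 (by norm_num)]) h4
    refine ⟨_, key, ?_⟩
    have d := fun j => (hasDerivAt_thetaMoment j hx0).const_mul 2
    have dS := (d 0).const_add 1
    have hid := hasDerivAt_id x
    have hC := (((dS.pow 2).mul (d 3)).sub (((dS.const_mul 3).mul (d 1)).mul (d 2))).add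
      (((d 1).pow 3).const_mul 2)
    have hB := (((dS.pow 2).const_mul (-3)).mul (d 2)).add ((dS.const_mul 3).mul ((d 1).pow 2))
    have hA := (dS.pow 2).mul (d 1)
    have h := (Real.hasDerivAt_exp x).mul ((((hid.pow 2).mul hC).add (hid.mul hB)).add hA)
    refine (h.congr_deriv ?_)
    simp only [Pi.pow_apply, Pi.mul_apply, Pi.add_apply, Pi.sub_apply, id]
    push_cast
    ring
  refine strictMonoOn_of_deriv_pos (convex_Ici 3) (fun x hx => ?_) fun x hx => ?_
  · obtain ⟨d, -, h⟩ := hd x hx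
    exact h.continuousAt.continuousWithinAt
  · rw [interior_Ici] at hx
    obtain ⟨d, h0, h⟩ := hd x (Set.mem_Ioi.1 hx).le
    rw [h.deriv]
    positivity

/-! ### Logarithm of θ in the variable log y -/

/-- `log θ(e^t) + t / 4`, an even function of `t`. -/
noncomputable def logTheta (t : ℝ) : ℝ :=
  Real.log (1 + 2 * thetaMoment 0 (Real.pi * Real.exp t)) + t / 4

/-- The first derivative of `logTheta`. -/
noncomputable def logThetaD1 (t : ℝ) : ℝ :=
  -(Real.pi * Real.exp t) * (2 * thetaMoment 1 (Real.pi * Real.exp t)) /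
    (1 + 2 * thetaMoment 0 (Real.pi * Real.exp t)) + 1 / 4

/-- The second derivative of `logTheta`. -/
noncomputable def logThetaD2 (t : ℝ) : ℝ :=
  (((Real.pi * Real.exp t) ^ 2 * (2 * thetaMoment 2 (Real.pi * Real.exp t))
      - (Real.pi * Real.exp t) * (2 * thetaMoment 1 (Real.pi * Real.exp t)))
      * (1 + 2 * thetaMoment 0 (Real.pi * Real.exp t))
    - (Real.pi * Real.exp t) ^ 2 * (2 * thetaMoment 1 (Real.pi * Real.exp t)) ^ 2) /
    (1 + 2 * thetaMoment 0 (Real.pi * Real.exp t)) ^ 2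

theorem thetaMoment_pos (j : ℕ) {x : ℝ} (hx : 0 < x) : 0 < thetaMoment j x :=
  (Real.exp_pos _).trans_le (exp_neg_le_thetaMoment j hx)

theorem hasDerivAt_thetaMoment_exp (j : ℕ) (t : ℝ) :
    HasDerivAt (fun t => 2 * thetaMoment j (Real.pi * Real.exp t))
      (-(Real.pi * Real.exp t) * (2 * thetaMoment (j + 1) (Real.pi * Real.exp t))) t := by
  have hx : 0 < Real.pi * Real.exp t := by positivity
  have h := ((hasDerivAt_thetaMoment j hx).comp t
    ((Real.hasDerivAt_exp t).const_mul Real.pi)).const_mul 2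
  exact h.congr_deriv (by ring)

theorem one_add_thetaMoment_pos (t : ℝ) : 0 < 1 + 2 * thetaMoment 0 (Real.pi * Real.exp t) := by
  have := thetaMoment_pos 0 (x := Real.pi * Real.exp t) (by positivity)
  linarith

theorem hasDerivAt_logTheta (t : ℝ) : HasDerivAt logTheta (logThetaD1 t) t := by
  have h := (((hasDerivAt_thetaMoment_exp 0 t).const_add 1).log
    (one_add_thetaMoment_pos t).ne').add ((hasDerivAt_id t).div_const 4)
  exact h

theorem hasDerivAt_logThetaD1 (t : ℝ) : HasDerivAt logThetaD1 (logThetaD2 t) t := by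
  have hS := (one_add_thetaMoment_pos t).ne'
  have hX := (Real.hasDerivAt_exp t).const_mul Real.pi
  have h := (((hX.neg.mul (hasDerivAt_thetaMoment_exp 1 t)).div
    ((hasDerivAt_thetaMoment_exp 0 t).const_add 1) hS)).add_const (1 / 4)
  refine h.congr_deriv ?_
  simp only [logThetaD2, Pi.neg_apply, Pi.mul_apply]
  congr 1
  ring

theorem hasDerivAt_logThetaD2 (t : ℝ) :
    HasDerivAt logThetaD2 (-(Real.pi * Real.exp t) * thetaThird (Real.pi * Real.exp t) /
      (1 + 2 * thetaMoment 0 (Real.pi * Real.exp t)) ^ 3) t := by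
  have hS := (one_add_thetaMoment_pos t).ne'
  have hX := (Real.hasDerivAt_exp t).const_mul Real.pi
  have d := fun j => hasDerivAt_thetaMoment_exp j t
  have dS := (d 0).const_add 1
  have h := (((((hX.pow 2).mul (d 2)).sub (hX.mul (d 1))).mul dS).sub
    ((hX.pow 2).mul ((d 1).pow 2))).div (dS.pow 2) (pow_ne_zero 2 hS)
  refine h.congr_deriv ?_
  simp only [Pi.pow_apply, Pi.mul_apply, Pi.sub_apply, thetaThird]
  rw [div_eq_div_iff (by positivity) (by positivity)]
  push_cast
  ring

theorem logTheta_eq (t : ℝ) : logTheta t = Real.log (thetaInt (Real.exp t)) + t / 4 := by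
  rw [logTheta, thetaInt_eq (Real.exp_pos t)]

theorem logTheta_neg (t : ℝ) : logTheta (-t) = logTheta t := by
  rw [logTheta_eq, logTheta_eq, Real.exp_neg, thetaInt_inv (Real.exp_pos t),
    Real.log_mul (by positivity) (thetaInt_pos (Real.exp_pos t)).ne',
    Real.log_sqrt (Real.exp_pos t).le, Real.log_exp]
  ring

theorem deriv_odd_of_even {f f' : ℝ → ℝ} (hf : ∀ t, HasDerivAt f (f' t) t)
    (h : ∀ t, f (-t) = f t) (t : ℝ) : f' (-t) = -f' t := by
  have h1 := (hf (-t)).comp t (hasDerivAt_neg t)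
  rw [show f ∘ Neg.neg = f from funext h] at h1
  linarith [h1.unique (hf t)]

theorem deriv_even_of_odd {f f' : ℝ → ℝ} (hf : ∀ t, HasDerivAt f (f' t) t)
    (h : ∀ t, f (-t) = -f t) (t : ℝ) : f' (-t) = f' t := by
  have h1 := (hf (-t)).comp t (hasDerivAt_neg t)
  rw [show f ∘ Neg.neg = -f from funext h] at h1
  linarith [h1.unique (hf t).neg]

/-- The third derivative of an even function is odd, hence zero at t = 0, that is, at x = π. -/
theorem thetaThird_pi : thetaThird Real.pi = 0 := by
  have h := deriv_odd_of_even hasDerivAt_logThetaD2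
    (deriv_even_of_odd hasDerivAt_logThetaD1 (deriv_odd_of_even hasDerivAt_logTheta logTheta_neg)) 0
  simp only [neg_zero, Real.exp_zero, mul_one] at h
  have h2 : -Real.pi * thetaThird Real.pi / (1 + 2 * thetaMoment 0 Real.pi) ^ 3 = 0 := by
    linarith
  have h3 := one_add_thetaMoment_pos 0
  rw [Real.exp_zero, mul_one] at h3
  have := Real.pi_ne_zero
  rw [div_eq_zero_iff, mul_eq_zero] at h2
  rcases h2 with (h2 | h2) | h2
  · exact absurd h2 (neg_ne_zero.2 this)
  · exact h2
  · exact absurd h2 (pow_ne_zero _ h3.ne')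

theorem logThetaD2_strictAntiOn : StrictAntiOn logThetaD2 (Set.Ici 0) := by
  refine strictAntiOn_of_deriv_neg (convex_Ici 0)
    (fun c _ => (hasDerivAt_logThetaD2 c).continuousAt.continuousWithinAt) fun t ht => ?_
  rw [interior_Ici, Set.mem_Ioi] at ht
  rw [(hasDerivAt_logThetaD2 t).deriv]
  have hpi := Real.pi_gt_three
  have h1 : Real.pi < Real.pi * Real.exp t := by
    have := Real.one_lt_exp_iff.2 ht
    nlinarith
  have h2 := thetaThird_strictMono (Set.mem_Ici.2 hpi.le) (Set.mem_Ici.2 (by linarith)) h1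
  simp only [thetaThird_pi, mul_zero] at h2
  have h3 : 0 < thetaThird (Real.pi * Real.exp t) := by
    by_contra h
    exact absurd h2 (not_lt.2 (mul_nonpos_of_nonneg_of_nonpos (Real.exp_pos _).le (not_lt.1 h)))
  have h4 := one_add_thetaMoment_pos t
  rw [neg_mul, neg_div, neg_lt_zero]
  positivity

/-- The linear terms t/4 in `logTheta` cancel because log 1 + log(pq) = log p + log q. What remains
is the second difference centred at s = log y + log(pq)/2. -/
theorem thetaInt_ratio_lt {p q : ℝ} (hp : 1 < p) (hpq : p ≤ q) {y : ℝ} (hy : 0 < y)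
    (hne : y ≠ 1 / Real.sqrt (p * q)) :
    thetaInt y * thetaInt (p * q * y) / (thetaInt (p * y) * thetaInt (q * y)) <
      thetaInt (1 / Real.sqrt (p * q)) * thetaInt (p * q * (1 / Real.sqrt (p * q))) /
        (thetaInt (p * (1 / Real.sqrt (p * q))) * thetaInt (q * (1 / Real.sqrt (p * q)))) := by
  have hp0 : 0 < p := by linarith
  have hq0 : 0 < q := by linarith
  have hlog : ∀ c y : ℝ, 0 < c → 0 < y → Real.log (thetaInt (c * y)) =
      logTheta (Real.log y + Real.log c) - (Real.log y + Real.log c) / 4 := by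
    intro c y hc hy
    rw [logTheta_eq, Real.exp_add, Real.exp_log hy, Real.exp_log hc, mul_comm y c]
    ring
  set Φ := fun s => logTheta (s - Real.log (p * q) / 2) + logTheta (s + Real.log (p * q) / 2) -
    logTheta (s - Real.log (q / p) / 2) - logTheta (s + Real.log (q / p) / 2) with hΦ
  have hrep : ∀ y : ℝ, 0 < y →
      thetaInt y * thetaInt (p * q * y) / (thetaInt (p * y) * thetaInt (q * y)) =
        Real.exp (Φ (Real.log y + Real.log (p * q) / 2)) := by
    intro y hy
    have t1 := thetaInt_pos hy
    have t2 := thetaInt_pos (mul_pos (mul_pos hp0 hq0) hy)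
    have t3 := thetaInt_pos (mul_pos hp0 hy)
    have t4 := thetaInt_pos (mul_pos hq0 hy)
    rw [← Real.exp_log (div_pos (mul_pos t1 t2) (mul_pos t3 t4)),
      Real.log_div (mul_pos t1 t2).ne' (mul_pos t3 t4).ne', Real.log_mul t1.ne' t2.ne',
      Real.log_mul t3.ne' t4.ne', hlog _ _ (mul_pos hp0 hq0) hy, hlog _ _ hp0 hy,
      hlog _ _ hq0 hy, show Real.log (thetaInt y) = Real.log (thetaInt (1 * y)) by rw [one_mul],
      hlog _ _ one_pos hy, Real.log_one]
    congr 1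
    simp only [hΦ]
    rw [Real.log_mul hp0.ne' hq0.ne', Real.log_div hq0.ne' hp0.ne']
    ring_nf
  have hsq : 0 < Real.sqrt (p * q) := Real.sqrt_pos.2 (mul_pos hp0 hq0)
  rw [hrep y hy, hrep _ (one_div_pos.2 hsq), Real.exp_lt_exp]
  have h0 : Real.log (1 / Real.sqrt (p * q)) + Real.log (p * q) / 2 = 0 := by
    rw [one_div, Real.log_inv, Real.log_sqrt (mul_pos hp0 hq0).le]
    ring
  have hs : Real.log y + Real.log (p * q) / 2 ≠ 0 := by
    intro h
    apply hne
    apply Real.log_injOn_pos (Set.mem_Ioi.2 hy) (Set.mem_Ioi.2 (one_div_pos.2 hsq))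
    linarith
  have hodd := deriv_odd_of_even hasDerivAt_logTheta logTheta_neg
  have h := second_difference_lt logTheta_neg hasDerivAt_logTheta hasDerivAt_logThetaD1 hodd
    (deriv_even_of_odd hasDerivAt_logThetaD1 hodd) logThetaD2_strictAntiOn
    (a := Real.log (p * q) / 2) (b := Real.log (q / p) / 2)
    (div_nonneg (Real.log_nonneg ((one_le_div hp0).2 hpq)) two_pos.le)
    (by
      have : Real.log (q / p) < Real.log (p * q) := by
        apply Real.log_lt_log (by positivity)
        rw [div_lt_iff₀ hp0]
        nlinarith [mul_pos hp0 hq0]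
      linarith) hs
  rw [h0]
  simpa [hΦ, logTheta_neg] using h

/-! ### The eta function on the imaginary axis -/

theorem norm_complexSqrt {z : ℂ} (hz : z ≠ 0) : ‖Complex.sqrt z‖ = Real.sqrt ‖z‖ := by
  rw [Complex.sqrt, Complex.norm_cpow_of_ne_zero hz, Real.sqrt_eq_rpow]
  norm_num

theorem summable_exp_eta {y : ℝ} (hy : 0 < y) :
    Summable fun n : ℕ => Real.exp (-2 * Real.pi * ((n : ℝ) + 1) * y) := by
  have h1 : Real.exp (-2 * Real.pi * y) < 1 := by
    rw [Real.exp_lt_one_iff]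
    nlinarith [mul_pos Real.pi_pos hy]
  have h := (summable_geometric_of_lt_one (Real.exp_pos _).le h1).mul_left
    (Real.exp (-2 * Real.pi * y))
  refine h.congr fun n => ?_
  rw [← Real.exp_nat_mul, ← Real.exp_add]
  ring_nf

theorem multipliable_eta {y : ℝ} (hy : 0 < y) :
    Multipliable fun n : ℕ => 1 - Real.exp (-2 * Real.pi * ((n : ℝ) + 1) * y) := by
  simpa [sub_eq_add_neg] using Real.multipliable_one_add_of_summable (summable_exp_eta hy).neg

theorem one_sub_exp_pos {x : ℝ} (hx : 0 < x) : 0 < 1 - Real.exp (-x) := by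
  have := Real.exp_lt_one_iff.2 (neg_lt_zero.2 hx)
  linarith

theorem eta_factor_pos {y : ℝ} (hy : 0 < y) (n : ℕ) :
    0 < 1 - Real.exp (-2 * Real.pi * ((n : ℝ) + 1) * y) := by
  have := one_sub_exp_pos (x := 2 * Real.pi * ((n : ℝ) + 1) * y) (by positivity)
  convert this using 3
  ring

theorem eta_pos {y : ℝ} (hy : 0 < y) : 0 < eta y := by
  refine mul_pos (Real.exp_pos _) (lt_of_le_of_ne ?_ (Ne.symm ?_))
  · exact ge_of_tendsto' (multipliable_eta hy).hasProd.tendsto_prod_nat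
      fun N => Finset.prod_nonneg fun n _ => (eta_factor_pos hy n).le
  · have h := tprod_one_add_ne_zero_of_summable
      (f := fun n : ℕ => -Real.exp (-2 * Real.pi * ((n : ℝ) + 1) * y))
      (fun n => by simpa [sub_eq_add_neg] using (eta_factor_pos hy n).ne')
      (by simpa using (summable_exp_eta hy))
    simpa [sub_eq_add_neg] using h

theorem eta_eq_modularForm_eta {y : ℝ} (hy : 0 < y) :
    ModularForm.eta (Complex.I * y) = (eta y : ℂ) := by
  have h := (multipliable_eta hy).map_tprod Complex.ofRealHom Complex.continuous_ofReal
  have h' : ((∏' n : ℕ, (1 - Real.exp (-2 * Real.pi * ((n : ℝ) + 1) * y)) : ℝ) : ℂ) =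
      ∏' n : ℕ, (1 - ModularForm.eta_q n (Complex.I * y)) := by
    refine h.trans (tprod_congr fun n => ?_)
    rw [ModularForm.eta_q_eq_cexp]
    simp only [Complex.ofRealHom_eq_coe]
    push_cast
    congr 2
    linear_combination (-2 * (Real.pi : ℂ) * (n + 1) * y) * Complex.I_sq
  rw [ModularForm.eta, eta, Complex.ofReal_mul, h', Function.Periodic.qParam]
  congr 1
  push_cast
  congr 1
  linear_combination ((Real.pi : ℂ) * y / 12) * Complex.I_sq

/-- Taking norms in the complex transformation law at z = iy removes the branch of the square root
and the constant of modulus 1. Nothing is lost, as `eta` is positive. -/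
theorem eta_inv {y : ℝ} (hy : 0 < y) : eta y⁻¹ = Real.sqrt y * eta y := by
  have hz : Complex.I * y ∈ UpperHalfPlane.upperHalfPlaneSet := by
    simpa [UpperHalfPlane.upperHalfPlaneSet] using hy
  have h := congrArg norm (ModularForm.eta_comp_eq_csqrt_I_inv hz)
  have e : -1 / (Complex.I * y) = Complex.I * ((y⁻¹ : ℝ) : ℂ) := by
    have : (y : ℂ) ≠ 0 := by exact_mod_cast hy.ne'
    push_cast
    field_simp
    exact Complex.I_sq.symm
  simp only [Function.comp_apply, Pi.smul_apply, Pi.mul_apply, smul_eq_mul, norm_mul, norm_inv] at h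
  rw [e, eta_eq_modularForm_eta hy, eta_eq_modularForm_eta (inv_pos.2 hy),
    norm_complexSqrt Complex.I_ne_zero, norm_complexSqrt (mul_ne_zero Complex.I_ne_zero
      (by exact_mod_cast hy.ne'))] at h
  simpa [abs_of_pos (eta_pos hy), abs_of_pos (eta_pos (inv_pos.2 hy)), abs_of_pos hy] using h

theorem tendsto_log_eta {y : ℝ} (hy : 0 < y) :
    Filter.Tendsto (fun N : ℕ => -Real.pi * y / 12 + ∑ n ∈ Finset.range N,
      Real.log (1 - Real.exp (-2 * Real.pi * ((n : ℝ) + 1) * y)))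
      Filter.atTop (nhds (Real.log (eta y))) := by
  have hP : ∏' n : ℕ, (1 - Real.exp (-2 * Real.pi * ((n : ℝ) + 1) * y)) ≠ 0 := by
    have := (eta_pos hy).ne'
    rw [eta] at this
    exact right_ne_zero_of_mul this
  have h := (multipliable_eta hy).hasProd.tendsto_prod_nat.log hP
  rw [eta, Real.log_mul (Real.exp_pos _).ne' hP, Real.log_exp]
  refine (h.const_add _).congr fun N => ?_
  rw [Real.log_prod fun n _ => (eta_factor_pos hy n).ne']

/-! ### Log-concavity of products of factors (1 + e^{-cw}) / (1 + e^{-w}) -/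

/-- `log (1 + exp (-x))`. -/
noncomputable def logOneAddExpNeg (x : ℝ) : ℝ := Real.log (1 + Real.exp (-x))

theorem log_one_sub_exp_two_mul {x : ℝ} (hx : 0 < x) :
    Real.log (1 - Real.exp (-(2 * x))) = Real.log (1 - Real.exp (-x)) + logOneAddExpNeg x := by
  rw [logOneAddExpNeg, ← Real.log_mul (one_sub_exp_pos hx).ne' (by positivity)]
  congr 1
  rw [show -(2 * x) = -x + -x by ring, Real.exp_add]
  ring

theorem hasDerivAt_logOneAddExpNeg (a t : ℝ) :
    HasDerivAt (fun t => logOneAddExpNeg (a * Real.exp t))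
      (-(a * Real.exp t / (Real.exp (a * Real.exp t) + 1))) t := by
  have h := ((((Real.hasDerivAt_exp t).const_mul a).neg.exp).const_add 1).log
    (by positivity : (1 : ℝ) + Real.exp (-(a * Real.exp t)) ≠ 0)
  refine h.congr_deriv ?_
  simp only [Pi.neg_apply]
  rw [Real.exp_neg]
  field_simp

theorem hasDerivAt_div_exp_add_one (c w : ℝ) :
    HasDerivAt (fun w => c * w / (Real.exp (c * w) + 1))
      (c * (Real.exp (c * w) + 1 - c * w * Real.exp (c * w)) / (Real.exp (c * w) + 1) ^ 2) w := by
  have h0 := (hasDerivAt_id w).const_mul c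
  have h := h0.div (h0.exp.add_const 1) (by positivity : Real.exp (c * w) + 1 ≠ 0)
  refine h.congr_deriv ?_
  simp only [id]
  ring

/-- The difference `w / (e^w + 1) - c w / (e^{cw} + 1)` decreases from `w₀` on. -/
def IsDecreasingFrom (c w₀ : ℝ) : Prop :=
  AntitoneOn (fun w => w / (Real.exp w + 1) - c * w / (Real.exp (c * w) + 1)) (Set.Ici w₀)

theorem isDecreasingFrom_of_le {c w₀ : ℝ}
    (h : ∀ w, w₀ ≤ w → (Real.exp w + 1 - w * Real.exp w) / (Real.exp w + 1) ^ 2 ≤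
      c * (Real.exp (c * w) + 1 - c * w * Real.exp (c * w)) / (Real.exp (c * w) + 1) ^ 2) :
    IsDecreasingFrom c w₀ := by
  have hd : ∀ w, HasDerivAt (fun w => w / (Real.exp w + 1) - c * w / (Real.exp (c * w) + 1))
      ((Real.exp w + 1 - w * Real.exp w) / (Real.exp w + 1) ^ 2 -
        c * (Real.exp (c * w) + 1 - c * w * Real.exp (c * w)) / (Real.exp (c * w) + 1) ^ 2) w :=
    fun w => by
      have h1 := hasDerivAt_div_exp_add_one 1 w
      simp only [one_mul] at h1
      exact h1.sub (hasDerivAt_div_exp_add_one c w)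
  refine antitoneOn_of_deriv_nonpos (convex_Ici w₀)
    (fun w _ => (hd w).continuousAt.continuousWithinAt)
    (fun w _ => (hd w).differentiableAt.differentiableWithinAt) fun w hw => ?_
  rw [interior_Ici] at hw
  rw [(hd w).deriv]
  linarith [h w (Set.mem_Ioi.1 hw).le]

/-- For large w the two derivatives behave like -w e^{-w} and -4w e^{-2w}, so the first is smaller.
With E = e^w the crude bounds need only E ≥ 10. -/
theorem isDecreasingFrom_two : IsDecreasingFrom 2 3 := by
  refine isDecreasingFrom_of_le fun w hw => ?_
  have hE : 19 ≤ Real.exp w := by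
    calc (19 : ℝ) ≤ 2.7 ^ 3 := by norm_num
      _ ≤ Real.exp 1 ^ 3 := by gcongr; linarith [Real.exp_one_gt_d9]
      _ = Real.exp 3 := by rw [← Real.exp_nat_mul]; norm_num
      _ ≤ Real.exp w := Real.exp_le_exp.2 hw
  have hF : Real.exp (2 * w) = Real.exp w ^ 2 := by rw [← Real.exp_nat_mul]; norm_num
  rw [hF]
  set E := Real.exp w
  rw [div_le_div_iff₀ (by positivity) (by positivity)]
  have h1 : E + 1 - w * E ≤ -(w / 2 * E) := by nlinarith
  have h2 : (E + 1) ^ 2 ≤ 5 / 4 * E ^ 2 := by nlinarith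
  have h3 : -(4 * w * E ^ 2) ≤ 2 * (E ^ 2 + 1 - 2 * w * E ^ 2) := by nlinarith [sq_nonneg E]
  have hw0 : 0 < w := by linarith
  calc (E + 1 - w * E) * (E ^ 2 + 1) ^ 2 ≤ -(w / 2 * E) * (E ^ 2 + 1) ^ 2 := by gcongr
    _ ≤ -(w / 2 * E) * (E ^ 2) ^ 2 := by
      rw [neg_mul, neg_mul, neg_le_neg_iff]
      gcongr
      linarith
    _ ≤ -(4 * w * E ^ 2) * (5 / 4 * E ^ 2) := by
      have : 0 ≤ w * E ^ 4 * (E - 10) := by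
        have : 0 ≤ E - 10 := by linarith
        positivity
      nlinarith
    _ ≤ -(4 * w * E ^ 2) * (E + 1) ^ 2 := by
      rw [neg_mul, neg_mul, neg_le_neg_iff]
      gcongr
    _ ≤ _ := by gcongr

/-- As for c = 2, with -16w e^{-4w} as the second derivative term; the crude bounds need only E³ ≥
64. -/
theorem isDecreasingFrom_four : IsDecreasingFrom 4 2 := by
  refine isDecreasingFrom_of_le fun w hw => ?_
  have hE : 7 ≤ Real.exp w := by
    calc (7 : ℝ) ≤ 2.7 ^ 2 := by norm_num
      _ ≤ Real.exp 1 ^ 2 := by gcongr; linarith [Real.exp_one_gt_d9]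
      _ = Real.exp 2 := by rw [← Real.exp_nat_mul]; norm_num
      _ ≤ Real.exp w := Real.exp_le_exp.2 hw
  have hF : Real.exp (4 * w) = Real.exp w ^ 4 := by rw [← Real.exp_nat_mul]; norm_num
  rw [hF]
  set E := Real.exp w
  rw [div_le_div_iff₀ (by positivity) (by positivity)]
  have h1 : E + 1 - w * E ≤ -(w / 3 * E) := by nlinarith
  have h2 : (E + 1) ^ 2 ≤ 4 / 3 * E ^ 2 := by nlinarith
  have h3 : -(16 * w * E ^ 4) ≤ 4 * (E ^ 4 + 1 - 4 * w * E ^ 4) := by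
    nlinarith [sq_nonneg (E ^ 2)]
  have hw0 : 0 < w := by linarith
  calc (E + 1 - w * E) * (E ^ 4 + 1) ^ 2 ≤ -(w / 3 * E) * (E ^ 4 + 1) ^ 2 := by gcongr
    _ ≤ -(w / 3 * E) * (E ^ 4) ^ 2 := by
      rw [neg_mul, neg_mul, neg_le_neg_iff]
      gcongr
      linarith
    _ ≤ -(16 * w * E ^ 4) * (4 / 3 * E ^ 2) := by
      have : 0 ≤ w * E ^ 6 * (E ^ 3 - 64) := by
        have : 0 ≤ E ^ 3 - 64 := by nlinarith [sq_nonneg E, mul_nonneg (sub_nonneg.2 hE) (sq_nonneg E)]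
        positivity
      nlinarith
    _ ≤ -(16 * w * E ^ 4) * (E + 1) ^ 2 := by
      rw [neg_mul, neg_mul, neg_le_neg_iff]
      gcongr
    _ ≤ _ := by gcongr

/-- With w = ae^t, the derivative in t is exactly the function in `IsDecreasingFrom`. -/
theorem concaveOn_logOneAddExpNeg_sub {c w₀ a t₀ : ℝ} (h : IsDecreasingFrom c w₀) (ha : 0 < a)
    (ht : w₀ ≤ a * Real.exp t₀) :
    ConcaveOn ℝ (Set.Ici t₀) fun t =>
      logOneAddExpNeg (c * a * Real.exp t) - logOneAddExpNeg (a * Real.exp t) := by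
  have hd := fun t => (hasDerivAt_logOneAddExpNeg (c * a) t).sub (hasDerivAt_logOneAddExpNeg a t)
  refine AntitoneOn.concaveOn_of_deriv (convex_Ici t₀)
    (fun t _ => (hd t).continuousAt.continuousWithinAt)
    (fun t _ => (hd t).differentiableAt.differentiableWithinAt) ?_
  intro s hs t ht' hst
  rw [interior_Ici, Set.mem_Ioi] at hs ht'
  have key : ∀ u, t₀ < u → w₀ ≤ a * Real.exp u := fun u hu => ht.trans (by gcongr)
  have := h (key s hs) (key t ht') (by gcongr)
  simp only [← mul_assoc] at this
  have e1 := (hd t).deriv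
  have e2 := (hd s).deriv
  simp only [Pi.sub_def] at e1 e2
  rw [e1, e2]
  linarith

theorem concaveOn_sum {ι : Type*} (s : Finset ι) {D : Set ℝ} (hD : Convex ℝ D) {f : ι → ℝ → ℝ}
    (h : ∀ i ∈ s, ConcaveOn ℝ D (f i)) : ConcaveOn ℝ D fun t => ∑ i ∈ s, f i t := by
  classical
  induction s using Finset.induction_on with
  | empty => simpa using concaveOn_const (0 : ℝ) hD
  | insert i s hi ih =>
    simp only [Finset.sum_insert hi]
    exact (h i (Finset.mem_insert_self _ _)).add
      (ih fun j hj => h j (Finset.mem_insert_of_mem hj))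

theorem concaveOn_of_tendsto {D : Set ℝ} (hD : Convex ℝ D) {f : ℕ → ℝ → ℝ} {g : ℝ → ℝ}
    (h : ∀ N, ConcaveOn ℝ D (f N))
    (hlim : ∀ t ∈ D, Filter.Tendsto (fun N => f N t) Filter.atTop (nhds (g t))) :
    ConcaveOn ℝ D g := by
  refine ⟨hD, fun x hx y hy a b ha hb hab => ?_⟩
  exact le_of_tendsto_of_tendsto'
    (((hlim x hx).const_smul a).add ((hlim y hy).const_smul b)) (hlim _ (hD hx hy ha hb hab))
    fun N => (h N).2 hx hy ha hb hab

/-- Product expansion `f y = exp (-β y) ∏_{n ≥ 1} (1 + e^{-cπny}) / (1 + e^{-πny})`. -/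
def HasWeberExpansion (c β : ℝ) (f : ℝ → ℝ) : Prop :=
  ∀ y, 0 < y → Filter.Tendsto (fun N : ℕ => -(β * y) + ∑ n ∈ Finset.range N,
    (logOneAddExpNeg (c * (Real.pi * ((n : ℝ) + 1)) * y) -
      logOneAddExpNeg (Real.pi * ((n : ℝ) + 1) * y))) Filter.atTop (nhds (Real.log (f y)))

theorem HasWeberExpansion.concaveOn {c β w₀ r t₀ : ℝ} {f : ℝ → ℝ} (hf : HasWeberExpansion c β f)
    (h : IsDecreasingFrom c w₀) (hβ : 0 ≤ β) (hr : 0 < r)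
    (ht : w₀ ≤ Real.pi * (r * Real.exp t₀)) :
    ConcaveOn ℝ (Set.Ici t₀) fun t => Real.log (f (r * Real.exp t)) := by
  have hpi := Real.pi_pos
  refine concaveOn_of_tendsto (convex_Ici t₀) (f := fun N t => -(β * (r * Real.exp t)) +
    ∑ n ∈ Finset.range N, (logOneAddExpNeg (c * (Real.pi * ((n : ℝ) + 1)) * (r * Real.exp t)) -
      logOneAddExpNeg (Real.pi * ((n : ℝ) + 1) * (r * Real.exp t)))) (fun N => ?_)
    fun t _ => hf _ (by positivity)
  refine ConcaveOn.add ?_ (concaveOn_sum _ (convex_Ici t₀) fun n _ => ?_)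
  · have := ((convexOn_exp.subset (Set.subset_univ (Set.Ici t₀)) (convex_Ici t₀)).smul
      (mul_nonneg hβ hr.le)).neg
    refine this.congr fun t _ => ?_
    simp [mul_assoc]
  · have hn : (0 : ℝ) ≤ n := Nat.cast_nonneg n
    have := concaveOn_logOneAddExpNeg_sub (a := Real.pi * ((n : ℝ) + 1) * r) (t₀ := t₀) h
      (by positivity) (ht.trans (by
        have : 0 ≤ Real.pi * (r * Real.exp t₀) * n := by positivity
        nlinarith))
    refine this.congr fun t _ => ?_
    simp only [mul_assoc]

/-- Since s - c may lie below t₀, evenness replaces it by c - s when 0 ≤ s ≤ c, and the midpoint is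
then c. For s > c the midpoint is s, and L decreases on the positive axis. -/
theorem shift_add_le_of_even_concave {L : ℝ → ℝ} {t₀ : ℝ} (ht₀ : t₀ < 0)
    (heven : ∀ t, L (-t) = L t) (hconc : ConcaveOn ℝ (Set.Ici t₀) L) (s : ℝ) {c : ℝ}
    (hc : 0 ≤ c) : L (s - c) + L (s + c) ≤ L c + L c := by
  have hmid : ∀ x y, t₀ ≤ x → t₀ ≤ y → L x + L y ≤ 2 * L ((x + y) / 2) := by
    intro x y hx hy
    have h := hconc.2 (Set.mem_Ici.2 hx) (Set.mem_Ici.2 hy) (by norm_num : (0 : ℝ) ≤ 1 / 2)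
      (by norm_num : (0 : ℝ) ≤ 1 / 2) (by norm_num)
    simp only [smul_eq_mul] at h
    rw [show 1 / 2 * x + 1 / 2 * y = (x + y) / 2 by ring] at h
    linarith
  have hanti : ∀ x y, 0 < x → x < y → L y ≤ L x := by
    intro x y hx hxy
    set e := min x (-t₀) / 2 with he
    have he0 : 0 < e := half_pos (lt_min hx (neg_pos.2 ht₀))
    have hex : e < x := by
      have := min_le_left x (-t₀)
      linarith
    have het : t₀ ≤ -e := by
      have := min_le_right x (-t₀)
      linarith
    -- By evenness the chord from -e to e has slope 0, so concavity makes all later slopes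
    -- nonpositive.
    have h1 := hconc.slope_anti_adjacent (x := -e) (y := e) (z := x) het
      (Set.mem_Ici.2 (by linarith)) (by linarith) hex
    have h2 := hconc.slope_anti_adjacent (x := e) (y := x) (z := y) (Set.mem_Ici.2 (by linarith))
      (Set.mem_Ici.2 (by linarith)) hex hxy
    rw [heven, sub_self, zero_div] at h1
    have h3 := h2.trans h1
    rw [div_nonpos_iff] at h3
    rcases h3 with h3 | h3 <;> linarith
  wlog hs : 0 ≤ s generalizing s
  · have h := this (-s) (by linarith)
    rw [show -s - c = -(s + c) by ring, show -s + c = -(s - c) by ring, heven, heven] at h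
    linarith
  rcases le_or_gt s c with hsc | hsc
  · have h := hmid (c - s) (s + c) (by linarith) (by linarith)
    rw [show s - c = -(c - s) by ring, heven]
    rw [show (c - s + (s + c)) / 2 = c by ring] at h
    linarith
  · have h := hmid (s - c) (s + c) (by linarith) (by linarith)
    rw [show (s - c + (s + c)) / 2 = s by ring] at h
    rcases hc.eq_or_lt with rfl | hc
    · have h0 : ∀ x, 0 < x → L x ≤ L 0 := by
        intro x hx
        have hm : 0 < min x (-t₀) := lt_min hx (neg_pos.2 ht₀)
        have h2 := hmid (-min x (-t₀)) (min x (-t₀)) (by linarith [min_le_right x (-t₀)])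
          (by linarith)
        rw [heven, neg_add_cancel, zero_div] at h2
        rcases (min_le_left x (-t₀)).eq_or_lt with h3 | h3
        · rw [h3] at h2
          linarith
        · linarith [hanti _ _ hm h3]
      linarith [h0 s hsc]
    · linarith [hanti c s hc hsc]

/-- In t = log(y/r) the inversion becomes t ↦ -t, and w₀ < πr says that concavity begins at some t₀
< 0. The pair y, py is s ∓ log(p)/2, centred at s = 0 exactly for y = r/√p. -/
theorem HasWeberExpansion.mul_le {c β w₀ r : ℝ} {f : ℝ → ℝ} (hf : HasWeberExpansion c β f)
    (h : IsDecreasingFrom c w₀) (hβ : 0 ≤ β) (hr : 0 < r) (hw₀ : 0 < w₀) (hrw : w₀ < Real.pi * r)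
    (hpos : ∀ y, 0 < y → 0 < f y) (hinv : ∀ y, 0 < y → f (r ^ 2 / y) = f y)
    {p y : ℝ} (hp : 1 ≤ p) (hy : 0 < y) :
    f y * f (p * y) ≤ f (r / Real.sqrt p) * f (p * (r / Real.sqrt p)) := by
  have hpi := Real.pi_pos
  have hp0 : 0 < p := by linarith
  set L := fun t => Real.log (f (r * Real.exp t)) with hL
  have heven : ∀ t, L (-t) = L t := by
    intro t
    simp only [hL]
    rw [← hinv (r * Real.exp t) (by positivity), Real.exp_neg]
    congr 2
    field_simp
  have hconc : ConcaveOn ℝ (Set.Ici (Real.log (w₀ / (Real.pi * r)))) L :=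
    hf.concaveOn h hβ hr (by
      rw [Real.exp_log (by positivity)]
      apply le_of_eq
      field_simp)
  have ht₀ : Real.log (w₀ / (Real.pi * r)) < 0 :=
    Real.log_neg (by positivity) ((div_lt_one (by positivity)).2 hrw)
  have hfL : ∀ x, 0 < x → f x = Real.exp (L (Real.log (x / r))) := by
    intro x hx
    simp only [hL]
    rw [Real.exp_log (div_pos hx hr), mul_div_cancel₀ _ hr.ne', Real.exp_log (hpos x hx)]
  have hc : 0 ≤ Real.log p / 2 := div_nonneg (Real.log_nonneg hp) two_pos.le
  have key := shift_add_le_of_even_concave ht₀ heven hconc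
    (Real.log (y / r) + Real.log p / 2) hc
  have hsq : 0 < Real.sqrt p := Real.sqrt_pos.2 hp0
  have e0 : Real.log (r / Real.sqrt p / r) = -(Real.log p / 2) := by
    rw [div_right_comm, div_self hr.ne', one_div, Real.log_inv, Real.log_sqrt hp0.le]
  rw [hfL y hy, hfL (p * y) (by positivity), hfL (r / Real.sqrt p) (by positivity),
    hfL (p * (r / Real.sqrt p)) (by positivity), ← Real.exp_add, ← Real.exp_add,
    mul_div_assoc p y, mul_div_assoc p (r / Real.sqrt p), Real.log_mul hp0.ne' (by positivity),
    Real.log_mul hp0.ne' (by positivity), e0, heven]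
  apply Real.exp_le_exp.2
  convert key using 2
  · congr 1; ring
  · congr 1; ring
  · congr 1; ring

/-! ### The two eta quotients -/

/-- `η(y/2) η(2y) / η(y)²`. -/
noncomputable def weberOdd (y : ℝ) : ℝ := eta (y / 2) * eta (2 * y) / eta y ^ 2

/-- `η(y/2) η(4y) / (η(y) η(2y))`. -/
noncomputable def weberEven (y : ℝ) : ℝ := eta (y / 2) * eta (4 * y) / (eta y * eta (2 * y))

theorem weberOdd_pos {y : ℝ} (hy : 0 < y) : 0 < weberOdd y := by
  have h1 := eta_pos hy
  have h2 := eta_pos (half_pos hy)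
  have h3 := eta_pos (mul_pos two_pos hy)
  rw [weberOdd]
  positivity

theorem weberEven_pos {y : ℝ} (hy : 0 < y) : 0 < weberEven y := by
  have h1 := eta_pos hy
  have h2 := eta_pos (half_pos hy)
  have h3 := eta_pos (mul_pos two_pos hy)
  have h4 := eta_pos (mul_pos four_pos hy)
  rw [weberEven]
  positivity

theorem weberOdd_inv {y : ℝ} (hy : 0 < y) : weberOdd (1 / y) = weberOdd y := by
  have h1 := (eta_pos hy).ne'
  have e1 : 1 / y / 2 = (2 * y)⁻¹ := by field_simp
  have e2 : 2 * (1 / y) = (y / 2)⁻¹ := by field_simp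
  have e3 : Real.sqrt (2 * y) * Real.sqrt (y / 2) = y := by
    rw [← Real.sqrt_mul (by positivity), show 2 * y * (y / 2) = y * y by ring,
      Real.sqrt_mul_self hy.le]
  rw [weberOdd, weberOdd, e1, e2, one_div, eta_inv hy, eta_inv (half_pos hy),
    eta_inv (mul_pos two_pos hy), mul_pow, Real.sq_sqrt hy.le, mul_mul_mul_comm, e3,
    mul_div_mul_left _ _ hy.ne', mul_comm (eta (2 * y))]

theorem weberEven_inv {y : ℝ} (hy : 0 < y) : weberEven (1 / 2 / y) = weberEven y := by
  have e1 : 1 / 2 / y / 2 = (4 * y)⁻¹ := by field_simp; norm_num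
  have e2 : 4 * (1 / 2 / y) = (y / 2)⁻¹ := by field_simp; norm_num
  have e3 : 1 / 2 / y = (2 * y)⁻¹ := by field_simp
  have e4 : 2 * (2 * y)⁻¹ = y⁻¹ := by field_simp
  have e5 : Real.sqrt (4 * y) * Real.sqrt (y / 2) = Real.sqrt (2 * y) * Real.sqrt y := by
    rw [← Real.sqrt_mul (by positivity), ← Real.sqrt_mul (by positivity)]
    congr 1
    ring
  have h0 : Real.sqrt (2 * y) * Real.sqrt y ≠ 0 := by positivity
  rw [weberEven, weberEven, e1, e2, e3, e4, eta_inv hy, eta_inv (half_pos hy),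
    eta_inv (mul_pos two_pos hy), eta_inv (mul_pos four_pos hy), mul_mul_mul_comm, e5,
    mul_mul_mul_comm (Real.sqrt (2 * y)) (eta (2 * y)), mul_div_mul_left _ _ h0, mul_comm (eta (4 * y)),
    mul_comm (eta (2 * y))]

theorem hasWeberExpansion_weberOdd : HasWeberExpansion 2 (Real.pi / 24) weberOdd := by
  intro y hy
  have hpi := Real.pi_pos
  have h1 := eta_pos hy
  have h2 := eta_pos (half_pos hy)
  have h3 := eta_pos (mul_pos two_pos hy)
  rw [weberOdd, Real.log_div (by positivity) (by positivity), Real.log_mul h2.ne' h3.ne',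
    Real.log_pow]
  refine (((tendsto_log_eta (half_pos hy)).add (tendsto_log_eta (mul_pos two_pos hy))).sub
    ((tendsto_log_eta hy).const_mul ((2 : ℕ) : ℝ))).congr fun N => ?_
  rw [Finset.sum_sub_distrib]
  -- With w = π(n+1)y: (1-e^{-w})(1-e^{-4w}) / (1-e^{-2w})² = (1+e^{-2w}) / (1+e^{-w}).
  have key : ∀ n : ℕ, Real.log (1 - Real.exp (-2 * Real.pi * ((n : ℝ) + 1) * (y / 2))) +
      Real.log (1 - Real.exp (-2 * Real.pi * ((n : ℝ) + 1) * (2 * y))) -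
      2 * Real.log (1 - Real.exp (-2 * Real.pi * ((n : ℝ) + 1) * y)) =
      logOneAddExpNeg (2 * (Real.pi * ((n : ℝ) + 1)) * y) -
      logOneAddExpNeg (Real.pi * ((n : ℝ) + 1) * y) := by
    intro n
    have hw : 0 < Real.pi * ((n : ℝ) + 1) * y := by positivity
    have k1 := log_one_sub_exp_two_mul hw
    have k2 := log_one_sub_exp_two_mul (mul_pos two_pos hw)
    rw [show -2 * Real.pi * ((n : ℝ) + 1) * (y / 2) = -(Real.pi * ((n : ℝ) + 1) * y) by ring,
      show -2 * Real.pi * ((n : ℝ) + 1) * (2 * y) =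
        -(2 * (2 * (Real.pi * ((n : ℝ) + 1) * y))) by ring,
      show -2 * Real.pi * ((n : ℝ) + 1) * y = -(2 * (Real.pi * ((n : ℝ) + 1) * y)) by ring,
      show 2 * (Real.pi * ((n : ℝ) + 1)) * y = 2 * (Real.pi * ((n : ℝ) + 1) * y) by ring]
    linarith
  rw [← Finset.sum_sub_distrib, ← Finset.sum_congr rfl fun n _ => key n, Finset.sum_sub_distrib,
    Finset.sum_add_distrib, ← Finset.mul_sum]
  push_cast
  ring

theorem hasWeberExpansion_weberEven : HasWeberExpansion 4 (Real.pi / 8) weberEven := by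
  intro y hy
  have hpi := Real.pi_pos
  have h1 := eta_pos hy
  have h2 := eta_pos (half_pos hy)
  have h3 := eta_pos (mul_pos two_pos hy)
  have h4 := eta_pos (mul_pos four_pos hy)
  rw [weberEven, Real.log_div (by positivity) (by positivity), Real.log_mul h2.ne' h4.ne',
    Real.log_mul h1.ne' h3.ne']
  refine (((tendsto_log_eta (half_pos hy)).add (tendsto_log_eta (mul_pos four_pos hy))).sub
    ((tendsto_log_eta hy).add (tendsto_log_eta (mul_pos two_pos hy)))).congr fun N => ?_
  -- With w = π(n+1)y: (1-e^{-w})(1-e^{-8w}) / ((1-e^{-2w})(1-e^{-4w})) = (1+e^{-4w}) / (1+e^{-w}).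
  have key : ∀ n : ℕ, Real.log (1 - Real.exp (-2 * Real.pi * ((n : ℝ) + 1) * (y / 2))) +
      Real.log (1 - Real.exp (-2 * Real.pi * ((n : ℝ) + 1) * (4 * y))) -
      (Real.log (1 - Real.exp (-2 * Real.pi * ((n : ℝ) + 1) * y)) +
        Real.log (1 - Real.exp (-2 * Real.pi * ((n : ℝ) + 1) * (2 * y)))) =
      logOneAddExpNeg (4 * (Real.pi * ((n : ℝ) + 1)) * y) -
      logOneAddExpNeg (Real.pi * ((n : ℝ) + 1) * y) := by
    intro n
    have hw : 0 < Real.pi * ((n : ℝ) + 1) * y := by positivity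
    have k1 := log_one_sub_exp_two_mul hw
    have k2 := log_one_sub_exp_two_mul (mul_pos four_pos hw)
    rw [show -2 * Real.pi * ((n : ℝ) + 1) * (y / 2) = -(Real.pi * ((n : ℝ) + 1) * y) by ring,
      show -2 * Real.pi * ((n : ℝ) + 1) * (4 * y) =
        -(2 * (4 * (Real.pi * ((n : ℝ) + 1) * y))) by ring,
      show -2 * Real.pi * ((n : ℝ) + 1) * (2 * y) =
        -(4 * (Real.pi * ((n : ℝ) + 1) * y)) by ring,
      show -2 * Real.pi * ((n : ℝ) + 1) * y = -(2 * (Real.pi * ((n : ℝ) + 1) * y)) by ring,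
      show 4 * (Real.pi * ((n : ℝ) + 1)) * y = 4 * (Real.pi * ((n : ℝ) + 1) * y) by ring]
    linarith
  rw [← Finset.sum_congr rfl fun n _ => key n, Finset.sum_sub_distrib,
    Finset.sum_add_distrib, Finset.sum_add_distrib]
  ring

theorem weberOdd_mul_le {p y : ℝ} (hp : 1 ≤ p) (hy : 0 < y) :
    weberOdd y * weberOdd (p * y) ≤
      weberOdd (1 / Real.sqrt p) * weberOdd (p * (1 / Real.sqrt p)) :=
  hasWeberExpansion_weberOdd.mul_le isDecreasingFrom_two (by positivity) one_pos (by norm_num)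
    (by linarith [Real.pi_gt_three]) (fun _ => weberOdd_pos)
    (fun y hy => by rw [one_pow]; exact weberOdd_inv hy) hp hy

theorem weberEven_mul_le {p y : ℝ} (hp : 1 ≤ p) (hy : 0 < y) :
    weberEven y * weberEven (p * y) ≤
      weberEven (1 / Real.sqrt (2 * p)) * weberEven (p * (1 / Real.sqrt (2 * p))) := by
  have h2 : (1.4 : ℝ) < Real.sqrt 2 := Real.lt_sqrt_of_sq_lt (by norm_num)
  have h2' : Real.sqrt 2 < 1.5 := by
    rw [Real.sqrt_lt' (by norm_num)]; norm_num
  -- The fixed point of y ↦ 1/(2y) is r = 1/√2, and w₀ = 2 is admissible because 2√2 < π.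
  have h := hasWeberExpansion_weberEven.mul_le (r := 1 / Real.sqrt 2) isDecreasingFrom_four
    (by positivity) (by positivity) (by norm_num)
    (by
      rw [mul_one_div, lt_div_iff₀ (by positivity)]
      linarith [Real.pi_gt_d2]) (fun _ => weberEven_pos)
    (fun y hy => by
      rw [div_pow, one_pow, Real.sq_sqrt two_pos.le]; exact weberEven_inv hy) hp hy
  rwa [div_div, ← Real.sqrt_mul two_pos.le] at h

/-! ### Bounds for g_ℓ -/

theorem etaDiv_prime {p : ℕ} (hp : p.Prime) (y : ℝ) : etaDiv p y = eta y * eta (p * y) := by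
  rw [etaDiv, hp.divisors, Finset.prod_pair hp.one_lt.ne]
  simp

theorem etaDiv_fifteen (y : ℝ) :
    etaDiv 15 y = eta y * eta (3 * y) * (eta (5 * y) * eta (15 * y)) := by
  rw [etaDiv, show Nat.divisors 15 = {1, 3, 5, 15} by decide]
  simp
  ring

theorem constD_div_pos {ℓ : ℕ} (hℓ : 0 < ℓ) : 0 < constD ℓ / (ℓ.divisors.card : ℝ) := by
  have h : (0 : ℝ) < ℓ.divisors.card := by
    exact_mod_cast Finset.card_pos.2 ⟨1, Nat.one_mem_divisors.2 hℓ.ne'⟩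
  have h' : (0 : ℝ) < ∏ p ∈ ℓ.primeFactors, ((p : ℝ) + 1) :=
    Finset.prod_pos fun p _ => by positivity
  rw [constD]
  positivity

theorem g_two_mul_prime {p : ℕ} (hp : p.Prime) (y : ℝ) :
    g (2 * p) y = (weberEven y * weberEven (p * y)) ^
      (constD (2 * p) / ((2 * p).divisors.card : ℝ)) := by
  rw [g, if_neg (by simp), Nat.mul_div_cancel_left p two_pos]
  simp only [etaDiv_prime hp, weberEven]
  congr 1
  rw [div_mul_div_comm]
  ring_nf

/-- The divisors are paired as {1, 15} and {3, 5}, and 5y is written as (5/3)(3y). Both pairs have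
geometric mean √15·y, so both are maximal at y = 1/√15. -/
theorem g_fifteen (y : ℝ) :
    g 15 y = (weberOdd y * weberOdd (15 * y) * (weberOdd (3 * y) * weberOdd (5 / 3 * (3 * y)))) ^
      (constD 15 / ((15 : ℕ).divisors.card : ℝ)) := by
  rw [g, if_pos (by decide)]
  simp only [etaDiv_fifteen, weberOdd]
  congr 1
  rw [div_mul_div_comm, div_mul_div_comm, div_mul_div_comm]
  ring_nf

theorem g_two_mul_prime_bounds {p : ℕ} (hp : p.Prime) {y : ℝ} (hy : 0 < y) :
    0 < g (2 * p) y ∧ g (2 * p) y ≤ g (2 * p) (1 / Real.sqrt ((2 * p : ℕ) : ℝ)) := by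
  have hp0 : (0 : ℝ) < p := by exact_mod_cast hp.pos
  have hpos := mul_pos (weberEven_pos hy) (weberEven_pos (mul_pos hp0 hy))
  rw [g_two_mul_prime hp, g_two_mul_prime hp]
  refine ⟨Real.rpow_pos_of_pos hpos _, Real.rpow_le_rpow hpos.le ?_
    (constD_div_pos (mul_pos two_pos hp.pos)).le⟩
  push_cast
  exact weberEven_mul_le (by exact_mod_cast hp.one_lt.le) hy

theorem g_fifteen_bounds {y : ℝ} (hy : 0 < y) :
    0 < g 15 y ∧ g 15 y ≤ g 15 (1 / Real.sqrt ((15 : ℕ) : ℝ)) := by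
  have h1 := mul_pos (weberOdd_pos hy) (weberOdd_pos (mul_pos (by norm_num : (0 : ℝ) < 15) hy))
  have hy3 : 0 < 3 * y := by positivity
  have h2 := mul_pos (weberOdd_pos hy3)
    (weberOdd_pos (mul_pos (by norm_num : (0 : ℝ) < 5 / 3) hy3))
  have e : 3 * (1 / Real.sqrt 15) = 1 / Real.sqrt (5 / 3) := by
    rw [show (15 : ℝ) = 3 ^ 2 * (5 / 3) by norm_num, Real.sqrt_mul (by norm_num),
      Real.sqrt_sq (by norm_num)]
    field_simp
  rw [g_fifteen, g_fifteen]
  refine ⟨Real.rpow_pos_of_pos (mul_pos h1 h2) _, Real.rpow_le_rpow (mul_pos h1 h2).le ?_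
    (constD_div_pos (by norm_num)).le⟩
  push_cast
  rw [e]
  have k1 := weberOdd_mul_le (p := 15) (by norm_num) hy
  exact mul_le_mul k1 (weberOdd_mul_le (by norm_num) hy3) h2.le (h1.le.trans k1)

theorem g_bounds {ℓ : ℕ} (hℓ : ℓ = 6 ∨ ℓ = 14 ∨ ℓ = 15) {y : ℝ} (hy : 0 < y) :
    0 < g ℓ y ∧ g ℓ y ≤ g ℓ (1 / Real.sqrt ℓ) := by
  rcases hℓ with rfl | rfl | rfl
  · exact g_two_mul_prime_bounds Nat.prime_three hy
  · exact g_two_mul_prime_bounds Nat.prime_seven hy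
  · exact g_fifteen_bounds hy

/-! ### Products of two primes and the conclusion -/

theorem divisors_prime_mul_prime {p q : ℕ} (hp : p.Prime) (hq : q.Prime) (hpq : p < q) :
    (p * q).divisors.card = 4 ∧ ∀ f : ℕ → ℝ,
      ∏ d ∈ (p * q).divisors, f d = f 1 * f p * (f q * f (p * q)) := by
  have hc : p.Coprime q := (Nat.coprime_primes hp hq).2 hpq.ne
  constructor
  · rw [hc.card_divisors_mul, hp.divisors, hq.divisors, Finset.card_pair hp.one_lt.ne,
      Finset.card_pair hq.one_lt.ne]
  · intro f
    rw [Nat.divisors_mul, Finset.mul_def, Finset.prod_image hc.mul_injOn_divisors,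
      Finset.prod_product,
      hp.divisors, hq.divisors, Finset.prod_pair hp.one_lt.ne, Finset.prod_pair hq.one_lt.ne,
      Finset.prod_pair hq.one_lt.ne]
    simp only [one_mul, mul_one]
    ring

theorem exists_prime_factors {ℓ : ℕ} (hℓ : ℓ = 6 ∨ ℓ = 14 ∨ ℓ = 15) :
    ∃ p q : ℕ, p.Prime ∧ q.Prime ∧ p < q ∧ ℓ = p * q := by
  rcases hℓ with rfl | rfl | rfl
  · exact ⟨2, 3, Nat.prime_two, Nat.prime_three, by norm_num, rfl⟩
  · exact ⟨2, 7, Nat.prime_two, Nat.prime_seven, by norm_num, rfl⟩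
  · exact ⟨3, 5, Nat.prime_three, Nat.prime_five, by norm_num, rfl⟩

/-- The quotient `Θ_{D^ℓ}² / Θ_{C^ℓ}` for `ℓ` a product of two primes. -/
theorem thetaD_sq_div_thetaC {p q : ℕ} (hp : p.Prime) (hq : q.Prime) (hpq : p < q) {y : ℝ}
    (hy : 0 < y) :
    theta (latticeD (p * q)) y ^ 2 / theta (latticeC (p * q)) y =
      thetaInt y * thetaInt (p * q * y) / (thetaInt (p * y) * thetaInt (q * y)) := by
  have hp0 : (0 : ℝ) < p := by exact_mod_cast hp.pos
  have hq0 : (0 : ℝ) < q := by exact_mod_cast hq.pos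
  have h1 := thetaInt_pos hy
  have h2 := thetaInt_pos (mul_pos (mul_pos hp0 hq0) hy)
  have h3 := thetaInt_pos (mul_pos hp0 hy)
  have h4 := thetaInt_pos (mul_pos hq0 hy)
  rw [theta_latticeD (mul_pos hp.pos hq.pos) hy, theta_latticeC _ hy,
    (divisors_prime_mul_prime hp hq hpq).2 fun d => thetaInt (d * y)]
  push_cast
  rw [one_mul]
  field_simp

end ModularLattice

theorem mainTheorem6 (ℓ : ℕ) (hℓ : ℓ = 6 ∨ ℓ = 14 ∨ ℓ = 15)
    (n : ℕ) (Λ : Submodule ℤ (EuclideanSpace ℝ (Fin n)))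
    [DiscreteTopology Λ] [IsZLattice ℝ Λ]
    (hmod : IsStronglyModular ℓ Λ)
    (k : ℕ) (hk : 0 < k)
    (hrat : RationallyEquivalent Λ (latticePow (latticeC ℓ) k) ∨
      RationalMatrixEquivalent Λ (latticePow (latticeC ℓ) k))
    (N : ℕ) (c : ℕ → ℝ)
    (htheta : ∀ y : ℝ, 0 < y →
      theta Λ y = theta (latticeC ℓ) y ^ k * ∑ i ∈ Finset.range (N + 1), c i * g ℓ y ^ i)
    (hpoly : ∀ x ∈ Set.Ioc 0 (g ℓ (1 / Real.sqrt ℓ)),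
      ∑ i ∈ Finset.range (N + 1), c i * x ^ i ≥
        ∑ i ∈ Finset.range (N + 1), c i * g ℓ (1 / Real.sqrt ℓ) ^ i) :
    HasUniqueGlobalMaxAt (modifiedSecrecy ℓ Λ) (1 / Real.sqrt ℓ) := by
  obtain ⟨p, q, hp, hq, hpq, hpqℓ⟩ := exists_prime_factors hℓ
  have hℓ0 : 0 < ℓ := hpqℓ ▸ mul_pos hp.pos hq.pos
  have hy₀ : 0 < 1 / Real.sqrt (ℓ : ℝ) :=
    one_div_pos.2 (Real.sqrt_pos.2 (by exact_mod_cast hℓ0))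
  have hn : n = k * 4 := by
    rw [card_eq_of_rationallyEquivalent hrat, hpqℓ, (divisors_prime_mul_prime hp hq hpq).1]
  have hC : ∀ y : ℝ, 0 < y → 0 < theta (latticeC ℓ) y := fun y hy => by
    rw [theta_latticeC _ hy]
    exact Finset.prod_pos fun d hd =>
      thetaInt_pos (mul_pos (by exact_mod_cast Nat.pos_of_mem_divisors hd) hy)
  have hD : ∀ y : ℝ, 0 < y → 0 < theta (latticeD ℓ) y := fun y hy => by
    rw [theta_latticeD hℓ0 hy]
    exact mul_pos (thetaInt_pos hy) (thetaInt_pos (mul_pos (by exact_mod_cast hℓ0) hy))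
  -- P(g) is a quotient of two positive theta values; its sign is needed to compare the fractions.
  have hP : ∀ y : ℝ, 0 < y → 0 < ∑ i ∈ Finset.range (N + 1), c i * g ℓ y ^ i := fun y hy =>
    pos_of_mul_pos_right (htheta y hy ▸ theta_pos Λ hy) (pow_pos (hC y hy) k).le
  have hrep : ∀ y : ℝ, 0 < y → modifiedSecrecy ℓ Λ y =
      (theta (latticeD ℓ) y ^ 2 / theta (latticeC ℓ) y) ^ k /
        ∑ i ∈ Finset.range (N + 1), c i * g ℓ y ^ i := fun y hy => by
    rw [modifiedSecrecy, htheta y hy, show (n : ℝ) / 2 = ((2 * k : ℕ) : ℝ) by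
      rw [hn]; push_cast; ring, Real.rpow_natCast, pow_mul, div_pow, div_div]
  refine ⟨hy₀, fun y hy hne => ?_⟩
  rw [hrep y hy, hrep _ hy₀]
  have hlt : theta (latticeD ℓ) y ^ 2 / theta (latticeC ℓ) y <
      theta (latticeD ℓ) (1 / Real.sqrt ℓ) ^ 2 / theta (latticeC ℓ) (1 / Real.sqrt ℓ) := by
    have hcast : (ℓ : ℝ) = p * q := by rw [hpqℓ]; push_cast; rfl
    rw [hcast] at hne hy₀ ⊢
    rw [hpqℓ, thetaD_sq_div_thetaC hp hq hpq hy, thetaD_sq_div_thetaC hp hq hpq hy₀]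
    exact thetaInt_ratio_lt (by exact_mod_cast hp.one_lt) (by exact_mod_cast hpq.le) hy hne
  have h0 : 0 ≤ theta (latticeD ℓ) y ^ 2 / theta (latticeC ℓ) y :=
    (div_pos (pow_pos (hD y hy) 2) (hC y hy)).le
  exact div_lt_div₀ (pow_lt_pow_left₀ hlt h0 hk.ne') (hpoly _ (g_bounds hℓ hy))
    (pow_nonneg (h0.trans hlt.le) k) (hP _ hy₀)
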